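/- Let $S=\{2^p3^q5^l : p,q,l\in\mathbb{N}_0\}$ be the set of $5$-smooth (Hamming) numbers, let $N_{2,3,5}(x)$ be the number of triples $(p,q,l)\in\mathbb{N}_0^3$ with $2^p3^q5^l\le x$ (equivalently, the number of elements of $S$ that are $\le x$), and let $\chi_S(x)=1$ if $x\in S$ and $\chi_S(x)=0$ otherwise. For real $t$ with fractional part $\{t\}$ put $B_1^*(\{t\})=\{t\}-\frac12$ if $t\notin\mathbb{Z}$ and $B_1^*(\{t\})=0$ if $t\in\mathbb{Z}$. For $x\ge1$, $R>0$ and $\{a,b,c\}=\{2,3,5\}$ define the truncated series $$C_{a,b}(x;R)=\sum_{k=1}^{\lfloor R\log a\rfloor}\frac{\cos\left(2\pi k\frac{\log x-\frac12\log b}{\log a}\right)}{k\sin\left(\frac{\pi k\log b}{\log a}\right)}+\sum_{k=1}^{\lfloor R\log b\rfloor}\frac{\cos\left(2\pi k\frac{\log x-\frac12\log a}{\log b}\right)}{k\sin\left(\frac{\pi k\log a}{\log b}\right)},$$ $$D_{a;b,c}(x;R)=\sum_{k=1}^{\lfloor R\log a\rfloor}\left(\frac{\sin\left(2\pi k\frac{\log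 x+\frac12\log b-\frac12\log c}{\log a}\right)}{k\sin\left(\frac{\pi k\log b}{\log a}\right)\sin\left(\frac{\pi k\log c}{\log a}\right)}+\frac{\sin\left(2\pi k\frac{\log x-\frac12\log b+\frac12\log c}{\log a}\right)}{k\sin\left(\frac{\pi k\log b}{\log a}\right)\sin\left(\frac{\pi k\log c}{\log a}\right)}\right).$$ Then there is a sequence of real numbers $R_j\to\infty$, independent of $x$, such that for every real number $x\ge1$ the limits $$C_{2,3}(x)=\lim_{j\to\infty}C_{2,3}(x;R_j),\quad C_{3,5}(x)=\lim_{j\to\infty}C_{3,5}(x;R_j),\quad C_{5,2}(x)=\lim_{j\to\infty}C_{5,2}(x;R_j),$$ $$D(x)=\lim_{j\to\infty}\bigl(D_{2;3,5}(x;R_j)+D_{3;2,5}(x;R_j)+D_{5;2,3}(x;R_j)\bigr)$$ exist, and $$\begin{aligned}N_{2,3,5}(x)&=\frac{(\log x)^3}{6\log2\log3\log5}+\frac{(\log x)^2}{4\log2\log3}+\frac{(\log x)^2}{4\log2\log5}+\frac{(\log x)^2}{4\log3\log5}+\frac{\log x}{4\log2}+\frac{\log x}{4\log3}+\frac{\log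 x}{4\log5}\\&\quad+\frac{\log2\log x}{12\log3\log5}+\frac{\log3\log x}{12\log2\log5}+\frac{\log5\log x}{12\log2\log3}\\&\quad+\frac{\log2}{24\log3}+\frac{\log2}{24\log5}+\frac{\log3}{24\log2}+\frac{\log3}{24\log5}+\frac{\log5}{24\log2}+\frac{\log5}{24\log3}+\frac18\\&\quad-B_1^*\left(\left\{\frac{\log x}{\log2}\right\}\right)-B_1^*\left(\left\{\frac{\log x}{\log3}\right\}\right)-B_1^*\left(\left\{\frac{\log x}{\log5}\right\}\right)\\&\quad-\frac1{4\pi}C_{2,3}(x)-\frac1{4\pi}C_{3,5}(x)-\frac1{4\pi}C_{5,2}(x)-\frac1{8\pi}D(x)+\frac12\chi_S(x).\end{aligned}$$ -/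

import Mathlib

open Filter Topology

noncomputable section

/-- The set `S_{a,b,c}` of natural numbers of the form `a^p * b^q * c^l`, `p, q, l ≥ 0`. -/
def smoothSet (a b c : ℕ) : Set ℕ :=
  {n | ∃ p q l : ℕ, n = a ^ p * b ^ q * c ^ l}

/-- `N_{a,b,c}(x)`: the number of triples of exponents `(p, q, l)` with `a^p b^q c^l ≤ x`. -/
def smoothCount (a b c : ℕ) (x : ℝ) : ℕ :=
  {t : ℕ × ℕ × ℕ | (a : ℝ) ^ t.1 * (b : ℝ) ^ t.2.1 * (c : ℝ) ^ t.2.2 ≤ x}.ncard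

open Classical in
/-- The characteristic function of `S_{a,b,c}`, as a function of a real variable. -/
def smoothChi (a b c : ℕ) (x : ℝ) : ℝ :=
  if ∃ n ∈ smoothSet a b c, (n : ℝ) = x then 1 else 0

open Classical in
/-- `B₁^*({t})`: equal to `{t} - 1/2` if `t` is not an integer and to `0` if `t` is an integer. -/
def bernoulliOneStar (t : ℝ) : ℝ :=
  if ∃ m : ℤ, (m : ℝ) = t then 0 else Int.fract t - 1 / 2

/-- The `k`-th term
`cos (2πk (log x - (1/2) log b) / log a) / (k sin (πk log b / log a))`. -/
def cosTerm (a b : ℕ) (x : ℝ) (k : ℕ) : ℝ :=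
  Real.cos (2 * Real.pi * k * ((Real.log x - 1 / 2 * Real.log b) / Real.log a)) /
    (k * Real.sin (Real.pi * k * Real.log b / Real.log a))

/-- The truncation at height `R` of the cosine series attached to the pair `a, b`: the terms with
denominator `log a` are summed for `1 ≤ k ≤ R log a`, those with denominator `log b` are summed
for `1 ≤ k ≤ R log b`. -/
def cosPairSum (a b : ℕ) (x R : ℝ) : ℝ :=
  (∑ k ∈ Finset.Icc 1 ⌊R * Real.log a⌋₊, cosTerm a b x k) +
    ∑ k ∈ Finset.Icc 1 ⌊R * Real.log b⌋₊, cosTerm b a x k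

/-- The `k`-th term of the sine series with denominator `log a`. -/
def sinTerm (a b c : ℕ) (x : ℝ) (k : ℕ) : ℝ :=
  Real.sin (2 * Real.pi * k *
      ((Real.log x + 1 / 2 * Real.log b - 1 / 2 * Real.log c) / Real.log a)) /
    (k * Real.sin (Real.pi * k * Real.log b / Real.log a) *
      Real.sin (Real.pi * k * Real.log c / Real.log a)) +
  Real.sin (2 * Real.pi * k *
      ((Real.log x - 1 / 2 * Real.log b + 1 / 2 * Real.log c) / Real.log a)) /
    (k * Real.sin (Real.pi * k * Real.log b / Real.log a) *
      Real.sin (Real.pi * k * Real.log c / Real.log a))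

/-- The truncation at height `R` (that is, to `1 ≤ k ≤ R log a`) of the sine series with
denominator `log a`. -/
def sinSum (a b c : ℕ) (x R : ℝ) : ℝ :=
  ∑ k ∈ Finset.Icc 1 ⌊R * Real.log a⌋₊, sinTerm a b c x k

end

/-!
For positive frequencies `a ∈ s` the function `exp (v z) / (z ∏ 2 sinh (a z / 2))` decays, for
`|v| < ∑ a / 2`, off the imaginary axis along circles `|z| = 2πR` that stay away from its poles, so
its integral over such circles tends to `0`. Replacing `v` by `v + a / 2` and by `v - a / 2` and
subtracting cancels the factor `2 sinh (a z / 2)`. The limit of the integral for all `v` therefore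
follows by induction on the number of frequencies from its values on a period `(-a / 2, a / 2]`,
where only the endpoint for a single frequency is not covered by the decay. For `v > -∑ a / 2` the
limit counts the lattice points `p` with `∑ p a ≤ v - ∑ a / 2`, those on the boundary with weight
`1 / 2`.

By the residue theorem the same integral is the residue at `0`, a polynomial in `v`, plus the
residues at `± 2πik / a`, `1 ≤ k ≤ R a`. One frequency gives the Fourier series of the sawtooth
`B₁*`, two frequencies give the cosine series, and for three frequencies
`sin (θ + φ + ψ) / (sin φ sin ψ)` splits into terms of the sawtooth, cosine and sine series.
The pigeonhole principle provides the radii: among `#s + 1` equally spaced ones with small spacing,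
at least one keeps its distance from the poles `2πik / a` of every frequency `a ∈ s`.
-/

/-- `c` is the residue of `f` at the isolated singularity `p`: some Laurent expansion of `f` at `p`
with finitely many terms has `c` as its coefficient of `(z - p)⁻¹` and a remainder of smaller
order than `(z - p)⁻¹`. To work with polynomials only, the expansion is multiplied by
`(z - p) ^ (n + 1)`. -/
def HasResidueAt (f : ℂ → ℂ) (p c : ℂ) : Prop :=
  ∃ (n : ℕ) (q : Polynomial ℂ),
    (fun z => (z - p) ^ (n + 1) * f z - q.eval (z - p)) =o[𝓝[≠] p] (fun z => (z - p) ^ n) ∧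
      q.coeff n = c

namespace HasResidueAt

variable {f g : ℂ → ℂ} {p c : ℂ}

theorem congr (hf : HasResidueAt f p c) (hfg : f =ᶠ[𝓝[≠] p] g) : HasResidueAt g p c := by
  obtain ⟨n, q, hq, rfl⟩ := hf
  refine ⟨n, q, hq.congr' ?_ EventuallyEq.rfl, rfl⟩
  filter_upwards [hfg] with z hz
  rw [hz]

theorem sub_of_continuousAt (hf : HasResidueAt f p c) (hg : ContinuousAt g p) :
    HasResidueAt (fun z => f z - g z) p c := by
  obtain ⟨n, q, hq, rfl⟩ := hf
  have hz : Tendsto (fun z : ℂ => (z - p) * g z) (𝓝[≠] p) (𝓝 0) := by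
    have h : ContinuousAt (fun z : ℂ => (z - p) * g z) p := by fun_prop
    simpa using h.tendsto.mono_left nhdsWithin_le_nhds
  have hg' : (fun z => (z - p) ^ n * ((z - p) * g z)) =o[𝓝[≠] p] (fun z => (z - p) ^ n) := by
    simpa using (Asymptotics.isBigO_refl (fun z : ℂ => (z - p) ^ n) (𝓝[≠] p)).mul_isLittleO
      ((Asymptotics.isLittleO_one_iff ℂ).2 hz)
  exact ⟨n, q, (hq.sub hg').congr_left fun z => by ring, rfl⟩

theorem of_hasDerivAt {h : ℂ → ℂ} {h' : ℂ} (hg : ContinuousAt g p) (hh : HasDerivAt h h' p)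
    (hp : h p = 0) (hh' : h' ≠ 0) : HasResidueAt (fun z => g z / h z) p (g p / h') := by
  refine ⟨0, Polynomial.C (g p / h'), ?_, Polynomial.coeff_C_zero⟩
  have hquot : Tendsto (fun z => g z * (slope h p z)⁻¹) (𝓝[≠] p) (𝓝 (g p * h'⁻¹)) :=
    (hg.tendsto.mono_left nhdsWithin_le_nhds).mul (hh.tendsto_slope.inv₀ hh')
  simp only [pow_zero, zero_add, pow_one, Polynomial.eval_C]
  refine (Asymptotics.isLittleO_one_iff ℂ).2 ?_
  rw [← tendsto_sub_nhds_zero_iff] at hquot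
  refine hquot.congr fun z => ?_
  rw [slope_def_field, hp, sub_zero, inv_div]
  ring

end HasResidueAt

section ResidueTheorem

variable {f : ℂ → ℂ} {c p : ℂ} {r : ℝ}

theorem circleIntegral_eval_sub_div_pow (hp : p ∈ Metric.ball c r) (q : Polynomial ℂ) (n : ℕ) :
    (∮ z in C(c, r), q.eval (z - p) / (z - p) ^ (n + 1)) = 2 * Real.pi * Complex.I * q.coeff n := by
  have hr : 0 < r := Metric.pos_of_mem_ball hp
  have hpc : ∀ z ∈ Metric.sphere c r, z - p ≠ 0 := fun z hz =>
    sub_ne_zero.2 (ne_of_mem_of_not_mem hz (Metric.mem_ball.1 hp).ne)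
  have hterm : ∀ k : ℕ, (∮ z in C(c, r), q.coeff k * (z - p) ^ ((k : ℤ) - (n + 1))) =
      if k = n then 2 * Real.pi * Complex.I * q.coeff n else 0 := by
    intro k
    rw [circleIntegral.integral_const_mul]
    split_ifs with hk
    · subst hk
      simp [circleIntegral.integral_sub_inv_of_mem_ball hp, mul_comm]
    · rw [circleIntegral.integral_sub_zpow_of_ne (by lia), mul_zero]
  calc (∮ z in C(c, r), q.eval (z - p) / (z - p) ^ (n + 1))
      = ∮ z in C(c, r), ∑ k ∈ Finset.range (q.natDegree + 1),
          q.coeff k * (z - p) ^ ((k : ℤ) - (n + 1)) := by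
        refine circleIntegral.integral_congr hr.le fun z hz => ?_
        simp only [Polynomial.eval_eq_sum_range, Finset.sum_div]
        refine Finset.sum_congr rfl fun k _ => ?_
        rw [zpow_sub₀ (hpc z hz), mul_div_assoc]
        norm_cast
    _ = 2 * Real.pi * Complex.I * q.coeff n := by
        rw [circleIntegral.integral_fun_sum]
        · simp only [hterm, Finset.sum_ite_eq', Finset.mem_range, ite_eq_left_iff, not_lt]
          intro h
          rw [Polynomial.coeff_eq_zero_of_natDegree_lt (by lia), mul_zero]
        · refine fun k _ => ContinuousOn.circleIntegrable hr.le ?_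
          exact continuousOn_const.mul
            ((continuousOn_id.sub continuousOn_const).zpow₀ _ fun z hz => Or.inl (hpc z hz))

theorem exists_differentiableAt_update_sub {d : ℂ}
    (hf : ∀ᶠ z in 𝓝[≠] p, DifferentiableAt ℂ f z) (hd : HasResidueAt f p d) :
    ∃ (n : ℕ) (q : Polynomial ℂ) (l : ℂ), q.coeff n = d ∧
      DifferentiableAt ℂ
        (Function.update (fun z => f z - q.eval (z - p) / (z - p) ^ (n + 1)) p l) p := by
  obtain ⟨n, q, hq, hqd⟩ := hd
  set g : ℂ → ℂ := fun z => f z - q.eval (z - p) / (z - p) ^ (n + 1) with hg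
  have hdiff : ∀ᶠ z in 𝓝[≠] p, DifferentiableAt ℂ g z := by
    filter_upwards [hf, self_mem_nhdsWithin] with z hz hzp
    have : (z - p) ^ (n + 1) ≠ 0 := pow_ne_zero _ (sub_ne_zero.2 hzp)
    fun_prop (disch := assumption)
  have hlittle : g =o[𝓝[≠] p] fun z => (z - p)⁻¹ := by
    refine (hq.mul_isBigO
      (Asymptotics.isBigO_refl (fun z : ℂ => ((z - p) ^ (n + 1))⁻¹) (𝓝[≠] p))).congr' ?_ ?_
    · filter_upwards [self_mem_nhdsWithin] with z hzp
      have : z - p ≠ 0 := sub_ne_zero.2 hzp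
      simp only [hg]
      field_simp
    · filter_upwards [self_mem_nhdsWithin] with z hzp
      have : z - p ≠ 0 := sub_ne_zero.2 hzp
      rw [pow_succ]
      field_simp
  have hconst : (fun _ => g p) =o[𝓝[≠] p] fun z => (z - p)⁻¹ := by
    refine Asymptotics.isLittleO_const_left.2 (Or.inr ?_)
    refine tendsto_norm_inv_nhdsNE_zero_atTop.comp (tendsto_nhdsWithin_iff.2 ⟨?_, ?_⟩)
    · have : ContinuousAt (fun z : ℂ => z - p) p := by fun_prop
      simpa using this.tendsto.mono_left nhdsWithin_le_nhds
    · filter_upwards [self_mem_nhdsWithin] with z hzp using sub_ne_zero.2 hzp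
  have hs : insert p {z | DifferentiableAt ℂ g z} ∈ 𝓝 p := insert_mem_nhds_iff.2 hdiff
  refine ⟨n, q, limUnder (𝓝[≠] p) g, hqd, ?_⟩
  refine (Complex.differentiableOn_update_limUnder_of_isLittleO hs ?_
    (hlittle.sub hconst)).differentiableAt hs
  exact fun z hz => (hz.1.resolve_left hz.2).differentiableWithinAt

theorem exists_circleIntegral_eq_add_residue {d : ℂ} (hp : p ∈ Metric.ball c r)
    (hf : ∀ᶠ z in 𝓝[≠] p, DifferentiableAt ℂ f z) (hfs : ContinuousOn f (Metric.sphere c r))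
    (hd : HasResidueAt f p d) :
    ∃ g F : ℂ → ℂ, (∀ z, z ≠ p → DifferentiableAt ℂ g z ∧ F =ᶠ[𝓝 z] fun w => f w - g w) ∧
      DifferentiableAt ℂ F p ∧
      (∮ z in C(c, r), f z) = 2 * Real.pi * Complex.I * d + ∮ z in C(c, r), F z := by
  have hr : 0 < r := Metric.pos_of_mem_ball hp
  have hsphere : ∀ z ∈ Metric.sphere c r, z ≠ p := fun z hz =>
    ne_of_mem_of_not_mem hz (Metric.mem_ball.1 hp).ne
  obtain ⟨n, q, l, rfl, hl⟩ := exists_differentiableAt_update_sub hf hd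
  set g : ℂ → ℂ := fun z => q.eval (z - p) / (z - p) ^ (n + 1) with hg
  have hgd : ∀ z, z ≠ p → DifferentiableAt ℂ g z := fun z hz => by
    have : (z - p) ^ (n + 1) ≠ 0 := pow_ne_zero _ (sub_ne_zero.2 hz)
    fun_prop (disch := assumption)
  refine ⟨g, Function.update (fun z => f z - g z) p l, fun z hz => ⟨hgd z hz, ?_⟩, hl, ?_⟩
  · filter_upwards [isOpen_ne.mem_nhds hz] with w hw using Function.update_of_ne hw _ _
  · have hgint : CircleIntegrable g c r := ContinuousOn.circleIntegrable hr.le fun z hz =>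
      (hgd z (hsphere z hz)).continuousAt.continuousWithinAt
    have hF : (∮ z in C(c, r), Function.update (fun z => f z - g z) p l z) =
        ∮ z in C(c, r), (f z - g z) :=
      circleIntegral.integral_congr hr.le fun z hz =>
        Function.update_of_ne (hsphere z hz) l fun z => f z - g z
    rw [hF, circleIntegral.integral_sub (hfs.circleIntegrable hr.le) hgint, hg,
      circleIntegral_eval_sub_div_pow hp]
    ring

theorem circleIntegral_eq_sum_residues {ι : Type*} (hr : 0 < r) (P : Finset ι) {pole res : ι → ℂ}
    (hinj : Set.InjOn pole P) (hP : ∀ i ∈ P, pole i ∈ Metric.ball c r)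
    (hf : ∀ z ∈ Metric.closedBall c r, (∀ i ∈ P, z ≠ pole i) → DifferentiableAt ℂ f z)
    (hres : ∀ i ∈ P, HasResidueAt f (pole i) (res i)) :
    (∮ z in C(c, r), f z) = 2 * Real.pi * Complex.I * ∑ i ∈ P, res i := by
  induction P using Finset.cons_induction generalizing f with
  | empty =>
    rw [Finset.sum_empty, mul_zero]
    have hdiff : ∀ z ∈ Metric.closedBall c r, DifferentiableAt ℂ f z := fun z hz =>
      hf z hz (by simp)
    exact Complex.circleIntegral_eq_zero_of_differentiable_on_off_countable hr.le
      Set.countable_empty (fun z hz => (hdiff z hz).continuousAt.continuousWithinAt)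
      fun z hz => hdiff z (Metric.ball_subset_closedBall hz.1)
  | cons i P hi ih =>
    simp only [Finset.mem_cons, forall_eq_or_imp] at hP hf hres
    have hne : ∀ j ∈ P, pole j ≠ pole i := fun j hj h =>
      hi (hinj (by simp [hj]) (by simp) h ▸ hj)
    have hnear : ∀ᶠ z in 𝓝[≠] pole i, DifferentiableAt ℂ f z := by
      have hP' : ∀ᶠ z in 𝓝 (pole i), ∀ j ∈ P, z ≠ pole j :=
        (Finset.eventually_all P).2 fun j hj => eventually_ne_nhds (hne j hj).symm
      filter_upwards [self_mem_nhdsWithin, nhdsWithin_le_nhds hP',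
        nhdsWithin_le_nhds (Metric.isOpen_ball.mem_nhds hP.1)] with z hz hzP hzball
      exact hf z (Metric.ball_subset_closedBall hzball) ⟨hz, hzP⟩
    have hsphere : ContinuousOn f (Metric.sphere c r) := fun z hz =>
      (hf z (Metric.sphere_subset_closedBall hz)
        ⟨ne_of_mem_of_not_mem hz (Metric.mem_ball.1 hP.1).ne, fun j hj =>
          ne_of_mem_of_not_mem hz (Metric.mem_ball.1 (hP.2 j hj)).ne⟩).continuousAt
        |>.continuousWithinAt
    obtain ⟨g, F, hg, hF, hint⟩ :=
      exists_circleIntegral_eq_add_residue hP.1 hnear hsphere hres.1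
    rw [hint, Finset.sum_cons, mul_add, ih (hinj.mono (by simp)) hP.2 (fun z hz hzP => ?_)
      fun j hj => ?_]
    · obtain rfl | hzi := eq_or_ne z (pole i)
      · exact hF
      · exact ((hf z hz ⟨hzi, hzP⟩).sub (hg z hzi).1).congr_of_eventuallyEq (hg z hzi).2
    · exact ((hres.2 j hj).sub_of_continuousAt (hg _ (hne j hj)).1.continuousAt).congr
        (nhdsWithin_le_nhds (hg _ (hne j hj)).2.symm)

end ResidueTheorem

section Sinh

theorem norm_sinh_sq (w : ℂ) :
    ‖Complex.sinh w‖ ^ 2 = Real.sinh w.re ^ 2 + Real.sin w.im ^ 2 := by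
  have hw : Complex.sinh w = (Real.sinh w.re * Real.cos w.im : ℝ) +
      (Real.cosh w.re * Real.sin w.im : ℝ) * Complex.I := by
    conv_lhs => rw [← Complex.re_add_im w, Complex.sinh_add, Complex.sinh_mul_I, Complex.cosh_mul_I]
    push_cast
    ring
  rw [hw, Complex.sq_norm, Complex.normSq_add_mul_I, mul_pow, mul_pow, Real.cosh_sq, Real.cos_sq']
  ring

theorem abs_sinh_re_le_norm_sinh (w : ℂ) : |Real.sinh w.re| ≤ ‖Complex.sinh w‖ :=
  abs_le_of_sq_le_sq (by linarith [norm_sinh_sq w, sq_nonneg (Real.sin w.im)]) (norm_nonneg _)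

theorem abs_sin_im_le_norm_sinh (w : ℂ) : |Real.sin w.im| ≤ ‖Complex.sinh w‖ :=
  abs_le_of_sq_le_sq (by linarith [norm_sinh_sq w, sq_nonneg (Real.sinh w.re)]) (norm_nonneg _)

theorem exp_sub_one_le_two_mul_sinh {t : ℝ} (ht : 1 ≤ t) : Real.exp (t - 1) ≤ 2 * Real.sinh t := by
  have htwo : 2 * Real.exp (t - 1) ≤ Real.exp t := by
    calc 2 * Real.exp (t - 1) ≤ Real.exp 1 * Real.exp (t - 1) := by
          gcongr
          linarith [Real.add_one_le_exp 1]
      _ = Real.exp t := by rw [← Real.exp_add, add_sub_cancel]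
  have hneg : Real.exp (-t) ≤ Real.exp (t - 1) := Real.exp_le_exp.2 (by linarith)
  rw [Real.sinh_eq]
  linarith

theorem norm_mul_norm_sub_abs_im_le {w : ℂ} (hw : |w.re| ≤ 1) : ‖w‖ * (‖w‖ - |w.im|) ≤ 1 := by
  have hsq : ‖w‖ ^ 2 = w.re ^ 2 + |w.im| ^ 2 := by
    rw [Complex.sq_norm, Complex.normSq_apply, sq_abs]
    ring
  have hre : w.re ^ 2 ≤ 1 := by rwa [sq_le_one_iff_abs_le_one]
  nlinarith [Complex.abs_im_le_norm w, abs_nonneg w.im]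

theorem half_le_abs_sin_im {κ : ℝ} {w : ℂ} (hκ : 0 < κ) (hw : 2 / κ ≤ ‖w‖)
    (hsin : κ ≤ |Real.sin ‖w‖|) (hre : |w.re| ≤ 1) : κ / 2 ≤ |Real.sin w.im| := by
  have hsub : ‖w‖ - |w.im| ≤ κ / 2 := by
    have h2 : 2 ≤ ‖w‖ * κ := (div_le_iff₀ hκ).1 hw
    nlinarith [norm_mul_norm_sub_abs_im_le hre, sub_nonneg.2 (Complex.abs_im_le_norm w)]
  have hlip := Real.abs_sin_sub_sin_le ‖w‖ |w.im|
  rw [abs_of_nonneg (sub_nonneg.2 (Complex.abs_im_le_norm w))] at hlip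
  have habs : |Real.sin (|w.im|)| = |Real.sin w.im| := by
    rcases abs_choice w.im with h | h <;> simp [h]
  linarith [abs_sub_abs_le_abs_sub (Real.sin ‖w‖) (Real.sin |w.im|)]

theorem mul_exp_le_norm_two_mul_sinh {κ : ℝ} {w : ℂ} (hκ : 0 < κ) (hw : 2 / κ ≤ ‖w‖)
    (hsin : κ ≤ |Real.sin ‖w‖|) : κ * Real.exp (|w.re| - 1) ≤ ‖2 * Complex.sinh w‖ := by
  rw [norm_mul, Complex.norm_ofNat]
  rcases le_total 1 |w.re| with hre | hre
  · calc κ * Real.exp (|w.re| - 1) ≤ 1 * Real.exp (|w.re| - 1) := by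
          gcongr
          exact hsin.trans (Real.abs_sin_le_one _)
      _ ≤ 2 * Real.sinh |w.re| := by
          rw [one_mul]
          exact exp_sub_one_le_two_mul_sinh hre
      _ = 2 * |Real.sinh w.re| := by rw [Real.abs_sinh]
      _ ≤ 2 * ‖Complex.sinh w‖ := by
          gcongr
          exact abs_sinh_re_le_norm_sinh w
  · calc κ * Real.exp (|w.re| - 1) ≤ κ * 1 := by
          gcongr
          exact Real.exp_le_one_iff.2 (by linarith)
      _ ≤ 2 * |Real.sin w.im| := by linarith [half_le_abs_sin_im hκ hw hsin hre]
      _ ≤ 2 * ‖Complex.sinh w‖ := by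
          gcongr
          exact abs_sin_im_le_norm_sinh w

end Sinh

section GrowingCircles

theorem ae_cos_ne_zero : ∀ᵐ θ : ℝ, Real.cos θ ≠ 0 := by
  have hcount : {θ : ℝ | Real.cos θ = 0}.Countable := by
    refine (Set.countable_range fun k : ℤ => (2 * (k : ℝ) + 1) * Real.pi / 2).mono fun θ hθ => ?_
    obtain ⟨k, hk⟩ := Real.cos_eq_zero_iff.1 hθ
    exact ⟨k, hk.symm⟩
  exact hcount.ae_notMem MeasureTheory.volume

theorem circleIntegral_eq_intervalIntegral_mul (f : ℂ → ℂ) (T : ℝ) :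
    (∮ z in C(0, T), f z) =
      ∫ θ in (0 : ℝ)..2 * Real.pi, Complex.I * (circleMap 0 T θ * f (circleMap 0 T θ)) := by
  rw [circleIntegral]
  refine intervalIntegral.integral_congr fun θ _ => ?_
  simp only [deriv_circleMap, smul_eq_mul]
  ring

theorem tendsto_circleIntegral_zero_of_norm_mul_le {f : ℂ → ℂ} (hf : Measurable f) {C δ : ℝ}
    (hδ : 0 < δ) {T : ℕ → ℝ} (hT : Tendsto T atTop atTop)
    (hbound : ∀ᶠ j in atTop, ∀ z : ℂ, ‖z‖ = T j → ‖z * f z‖ ≤ C * Real.exp (-δ * |z.re|)) :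
    Tendsto (fun j => ∮ z in C(0, T j), f z) atTop (𝓝 0) := by
  have hpoint : ∀ᶠ j in atTop, ∀ θ,
      ‖Complex.I * (circleMap 0 (T j) θ * f (circleMap 0 (T j) θ))‖ ≤
        C * Real.exp (-(δ * |Real.cos θ| * T j)) := by
    filter_upwards [hbound, hT.eventually_gt_atTop 0] with j hj hTj θ
    have hre : (circleMap 0 (T j) θ).re = T j * Real.cos θ := by simp [circleMap, Complex.exp_re]
    rw [norm_mul, Complex.norm_I, one_mul]
    refine (hj _ (by rw [norm_circleMap_zero, abs_of_pos hTj])).trans (le_of_eq ?_)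
    rw [hre, abs_mul, abs_of_pos hTj]
    ring_nf
  simp only [circleIntegral_eq_intervalIntegral_mul]
  suffices h : Tendsto (fun j => ∫ θ in (0 : ℝ)..2 * Real.pi,
      Complex.I * (circleMap 0 (T j) θ * f (circleMap 0 (T j) θ))) atTop
      (𝓝 (∫ _ in (0 : ℝ)..2 * Real.pi, 0)) by simpa using h
  refine intervalIntegral.tendsto_integral_filter_of_dominated_convergence (fun _ => |C|)
    (Eventually.of_forall fun j => ?_) ?_ intervalIntegrable_const ?_
  · have hcircle : Measurable (circleMap 0 (T j)) := (continuous_circleMap _ _).measurable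
    exact (measurable_const.mul (hcircle.mul (hf.comp hcircle))).aestronglyMeasurable
  · filter_upwards [hpoint, hT.eventually_gt_atTop 0] with j hj hTj
    refine Eventually.of_forall fun θ _ => (hj θ).trans ?_
    calc C * Real.exp (-(δ * |Real.cos θ| * T j))
        ≤ |C| * 1 := by
          gcongr
          · exact le_abs_self C
          · exact Real.exp_le_one_iff.2 (neg_nonpos.2 (by positivity))
      _ = |C| := mul_one _
  · filter_upwards [ae_cos_ne_zero] with θ hθ _
    have hexp : Tendsto (fun j => δ * |Real.cos θ| * T j) atTop atTop :=
      hT.const_mul_atTop (mul_pos hδ (abs_pos.2 hθ))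
    refine squeeze_zero_norm' (hpoint.mono fun j hj => hj θ) ?_
    simpa using (Real.tendsto_exp_neg_atTop_nhds_zero.comp hexp).const_mul C

end GrowingCircles

section Kernel

/-- The meromorphic function `exp (v z) / (z ∏ 2 sinh (a z / 2))`, the product running over the
frequencies `a ∈ s`. Its residue at `0` is a polynomial in `v`, its other residues are oscillating
in `v`. -/
noncomputable def sinhKernel (s : Finset ℝ) (v : ℝ) (z : ℂ) : ℂ :=
  Complex.exp (v * z) / (z * ∏ a ∈ s, 2 * Complex.sinh (a * z / 2))

/-- The sum of the residues of `sinhKernel s v` in the disc of radius `T`, as a contour integral. -/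
noncomputable def kernelIntegral (s : Finset ℝ) (v T : ℝ) : ℂ :=
  (2 * Real.pi * Complex.I)⁻¹ * ∮ z in C(0, T), sinhKernel s v z

/-- The circles `|z| = 2πR j` keep away from the poles `2πin / a` of `sinhKernel s v`, uniformly
in `j`. -/
def AvoidsPoles (R : ℕ → ℝ) (s : Finset ℝ) : Prop :=
  ∃ κ : ℝ, 0 < κ ∧ ∀ j, ∀ a ∈ s, κ ≤ |Real.sin (a * (2 * Real.pi * R j) / 2)|

variable {s : Finset ℝ} {R : ℕ → ℝ}

theorem AvoidsPoles.mono {t : Finset ℝ} (h : AvoidsPoles R s) (hts : t ⊆ s) : AvoidsPoles R t := by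
  obtain ⟨κ, hκ, hs⟩ := h
  exact ⟨κ, hκ, fun j a ha => hs j a (hts ha)⟩

theorem AvoidsPoles.sin_ne_zero (h : AvoidsPoles R s) (j : ℕ) :
    ∀ a ∈ s, Real.sin (a * (2 * Real.pi * R j) / 2) ≠ 0 := by
  obtain ⟨κ, hκ, hs⟩ := h
  exact fun a ha => abs_pos.1 (hκ.trans_le (hs j a ha))

theorem norm_ofReal_mul_div_two {a : ℝ} (ha : 0 < a) (z : ℂ) : ‖(a * z / 2 : ℂ)‖ = a * ‖z‖ / 2 := by
  simp [abs_of_pos ha]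

theorem ofReal_mul_div_two_re (a : ℝ) (z : ℂ) : (a * z / 2 : ℂ).re = a * z.re / 2 := by
  simp

theorem sinh_ne_zero_of_sin_norm_ne_zero {w : ℂ} (hw : Real.sin ‖w‖ ≠ 0) :
    Complex.sinh w ≠ 0 := by
  intro h
  have hre : w.re = 0 := by simpa [h] using abs_sinh_re_le_norm_sinh w
  have him : Real.sin w.im = 0 := by simpa [h] using abs_sin_im_le_norm_sinh w
  have hnorm : ‖w‖ = |w.im| := by
    rw [← Complex.re_add_im w, hre]
    simp
  rw [hnorm] at hw
  rcases abs_choice w.im with h | h <;> simp [h, him] at hw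

theorem two_mul_sinh_ne_zero_of_norm_eq {a T : ℝ} (ha : 0 < a) (hT : Real.sin (a * T / 2) ≠ 0)
    {z : ℂ} (hz : ‖z‖ = T) : 2 * Complex.sinh (a * z / 2) ≠ 0 := by
  refine mul_ne_zero two_ne_zero (sinh_ne_zero_of_sin_norm_ne_zero ?_)
  rwa [norm_ofReal_mul_div_two ha, hz]

theorem differentiableAt_sinhKernel {v : ℝ} {z : ℂ} (hz : z ≠ 0)
    (hs : ∀ a ∈ s, 2 * Complex.sinh (a * z / 2) ≠ 0) :
    DifferentiableAt ℂ (sinhKernel s v) z := by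
  have hden : z * ∏ a ∈ s, 2 * Complex.sinh (a * z / 2) ≠ 0 :=
    mul_ne_zero hz (Finset.prod_ne_zero_iff.2 hs)
  unfold sinhKernel
  fun_prop (disch := assumption)

theorem circleIntegrable_sinhKernel {v T : ℝ} (hpos : ∀ a ∈ s, 0 < a) (hT : 0 < T)
    (hsin : ∀ a ∈ s, Real.sin (a * T / 2) ≠ 0) : CircleIntegrable (sinhKernel s v) 0 T := by
  refine ContinuousOn.circleIntegrable hT.le fun z hz => ?_
  have hnorm : ‖z‖ = T := mem_sphere_zero_iff_norm.1 hz
  refine (differentiableAt_sinhKernel (norm_pos_iff.1 (hnorm ▸ hT)) fun a ha => ?_).continuousAt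
    |>.continuousWithinAt
  exact two_mul_sinh_ne_zero_of_norm_eq (hpos a ha) (hsin a ha) hnorm

theorem kernelIntegral_empty (v : ℝ) {T : ℝ} (hT : 0 < T) : kernelIntegral ∅ v T = 1 := by
  have hres : HasResidueAt (fun z : ℂ => Complex.exp (v * z) / z) 0
      (Complex.exp (v * 0) / 1) :=
    HasResidueAt.of_hasDerivAt (by fun_prop) (hasDerivAt_id 0) rfl one_ne_zero
  have hint := circleIntegral_eq_sum_residues (c := 0) hT {0} (pole := id)
    (f := fun z : ℂ => Complex.exp (v * z) / z) (res := fun _ => Complex.exp (v * 0) / 1)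
    Function.injective_id.injOn (by simpa using hT)
    (fun z _ hz => by
      have : z ≠ 0 := by simpa using hz
      fun_prop (disch := assumption))
    (by simpa only [Finset.mem_singleton, forall_eq, id] using hres)
  simp only [mul_zero, Complex.exp_zero, div_one, Finset.sum_const, Finset.card_singleton,
    one_smul, mul_one] at hint
  simp only [kernelIntegral, sinhKernel, Finset.prod_empty, mul_one, hint]
  exact inv_mul_cancel₀ Complex.two_pi_I_ne_zero

theorem sinhKernel_insert_sub {a : ℝ} (ha : a ∉ s) (v : ℝ) {z : ℂ}
    (hz : 2 * Complex.sinh (a * z / 2) ≠ 0) :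
    sinhKernel (insert a s) (v + a / 2) z - sinhKernel (insert a s) (v - a / 2) z =
      sinhKernel s v z := by
  have hexp : Complex.exp ((v + a / 2 : ℝ) * z) - Complex.exp ((v - a / 2 : ℝ) * z) =
      2 * Complex.sinh (a * z / 2) * Complex.exp (v * z) := by
    rw [Complex.two_sinh, sub_mul, ← Complex.exp_add, ← Complex.exp_add]
    push_cast
    ring_nf
  rw [sinhKernel, sinhKernel, ← sub_div, hexp, Finset.prod_insert ha, mul_left_comm z,
    mul_div_mul_left _ _ hz, sinhKernel]

theorem kernelIntegral_insert_sub {a : ℝ} (ha : a ∉ s) (hpos : ∀ b ∈ insert a s, 0 < b) (v : ℝ)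
    {T : ℝ} (hT : 0 < T) (hsin : ∀ b ∈ insert a s, Real.sin (b * T / 2) ≠ 0) :
    kernelIntegral (insert a s) (v + a / 2) T - kernelIntegral (insert a s) (v - a / 2) T =
      kernelIntegral s v T := by
  have haS : a ∈ insert a s := Finset.mem_insert_self a s
  rw [kernelIntegral, kernelIntegral, ← mul_sub, ← circleIntegral.integral_sub
    (circleIntegrable_sinhKernel hpos hT hsin) (circleIntegrable_sinhKernel hpos hT hsin)]
  refine congrArg _ (circleIntegral.integral_congr hT.le fun z hz => ?_)
  exact sinhKernel_insert_sub ha v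
    (two_mul_sinh_ne_zero_of_norm_eq (hpos a haS) (hsin a haS) (mem_sphere_zero_iff_norm.1 hz))

theorem norm_mul_sinhKernel_le {κ v : ℝ} {z : ℂ} (hκ : 0 < κ) (hpos : ∀ a ∈ s, 0 < a)
    (hz : z ≠ 0) (hlarge : ∀ a ∈ s, 2 / κ ≤ a * ‖z‖ / 2)
    (hsin : ∀ a ∈ s, κ ≤ |Real.sin (a * ‖z‖ / 2)|) :
    ‖z * sinhKernel s v z‖ ≤
      (∏ _a ∈ s, κ * Real.exp (-1))⁻¹ * Real.exp (-(∑ a ∈ s, a / 2 - |v|) * |z.re|) := by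
  have hden : (∏ _a ∈ s, κ * Real.exp (-1)) * Real.exp ((∑ a ∈ s, a / 2) * |z.re|) ≤
      ‖∏ a ∈ s, 2 * Complex.sinh (a * z / 2)‖ := by
    rw [norm_prod, Finset.sum_mul, Real.exp_sum, ← Finset.prod_mul_distrib]
    refine Finset.prod_le_prod (fun a _ => by positivity) fun a ha => ?_
    have hnorm := norm_ofReal_mul_div_two (hpos a ha) z
    refine le_trans (le_of_eq ?_) (mul_exp_le_norm_two_mul_sinh hκ
      (hnorm ▸ hlarge a ha) (hnorm ▸ hsin a ha))
    rw [ofReal_mul_div_two_re, abs_div, abs_mul, abs_of_pos (hpos a ha), abs_two, mul_assoc,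
      ← Real.exp_add]
    ring_nf
  have hnum : ‖Complex.exp (v * z)‖ ≤ Real.exp (|v| * |z.re|) := by
    rw [Complex.norm_exp, Complex.re_ofReal_mul, ← abs_mul]
    exact Real.exp_le_exp.2 (le_abs_self _)
  rw [sinhKernel, mul_div_assoc', mul_div_mul_left _ _ hz, norm_div]
  refine (div_le_div₀ (Real.exp_nonneg _) hnum (by positivity) hden).trans (le_of_eq ?_)
  rw [neg_mul, sub_mul, neg_sub, Real.exp_sub]
  field_simp

theorem tendsto_kernelIntegral_zero (hpos : ∀ a ∈ s, 0 < a) {v : ℝ}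
    (hv : |v| < ∑ a ∈ s, a / 2) (hR : Tendsto R atTop atTop) (hav : AvoidsPoles R s) :
    Tendsto (fun j => kernelIntegral s v (2 * Real.pi * R j)) atTop (𝓝 0) := by
  obtain ⟨κ, hκ, hsin⟩ := hav
  have hT : Tendsto (fun j => 2 * Real.pi * R j) atTop atTop :=
    hR.const_mul_atTop Real.two_pi_pos
  have hlarge : ∀ᶠ j in atTop, ∀ a ∈ s, 2 / κ ≤ a * (2 * Real.pi * R j) / 2 :=
    (Finset.eventually_all s).2 fun a ha =>
      ((hT.const_mul_atTop (hpos a ha)).atTop_div_const two_pos).eventually_ge_atTop _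
  have hmeas : Measurable (sinhKernel s v) := by
    unfold sinhKernel
    fun_prop
  have hint := tendsto_circleIntegral_zero_of_norm_mul_le hmeas
    (C := (∏ _a ∈ s, κ * Real.exp (-1))⁻¹) (sub_pos.2 hv) hT ?_
  · simpa only [kernelIntegral, mul_zero] using hint.const_mul (2 * Real.pi * Complex.I)⁻¹
  · filter_upwards [hlarge, hT.eventually_gt_atTop 0] with j hj hTj z hz
    have hz0 : z ≠ 0 := norm_pos_iff.1 (hz ▸ hTj)
    exact norm_mul_sinhKernel_le hκ hpos hz0 (hz ▸ hj) (hz ▸ hsin j)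

end Kernel

section Residues

theorem sin_pi_mul_int_mul_ne_zero {θ : ℝ} (hθ : Irrational θ) {n : ℤ} (hn : n ≠ 0) :
    Real.sin (Real.pi * (n * θ)) ≠ 0 := fun h => by
  obtain ⟨m, hm⟩ := Real.sin_eq_zero_iff.1 h
  have hm' : (m : ℝ) = n * θ := by
    rwa [mul_comm, mul_right_inj' Real.pi_ne_zero] at hm
  exact (hθ.intCast_mul hn).ne_int m hm'.symm

/-- The zero `2πin / a` of `z ↦ sinh (a z / 2)`. -/
noncomputable def sinhPole (a : ℝ) (n : ℤ) : ℂ := 2 * Real.pi * n * Complex.I / a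

/-- The residue of `sinhKernel s v` at its pole `2πin / a`. -/
noncomputable def sinhResidue (s : Finset ℝ) (v a : ℝ) (n : ℤ) : ℂ :=
  Complex.exp ((2 * Real.pi * n * (v / a) : ℝ) * Complex.I) /
    (2 * Real.pi * n * (-1) ^ n * Complex.I ^ s.card *
      ∏ b ∈ s.erase a, 2 * (Real.sin (Real.pi * (n * (b / a))) : ℂ))

/-- The sum of the residues of `sinhKernel s v` at `2πik / a` and `-2πik / a`. -/
noncomputable def residuePair (s : Finset ℝ) (v a : ℝ) (k : ℕ) : ℝ :=
  (-1) ^ k * Real.cos (2 * Real.pi * k * (v / a) - s.card * (Real.pi / 2)) /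
    (Real.pi * k * ∏ b ∈ s.erase a, 2 * Real.sin (Real.pi * (k * (b / a))))

variable {s : Finset ℝ} {a : ℝ} {n : ℤ}

theorem mul_sinhPole_div_two (b : ℝ) :
    (b * sinhPole a n / 2 : ℂ) = (Real.pi * (n * (b / a)) : ℝ) * Complex.I := by
  simp only [sinhPole]
  push_cast
  ring

theorem two_mul_sinh_sinhPole (b : ℝ) : 2 * Complex.sinh (b * sinhPole a n / 2) =
    2 * (Real.sin (Real.pi * (n * (b / a))) : ℂ) * Complex.I := by
  rw [mul_sinhPole_div_two, Complex.sinh_mul_I, Complex.ofReal_sin, mul_assoc]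

theorem two_mul_sinh_eq_zero_iff (ha : a ≠ 0) {z : ℂ} :
    2 * Complex.sinh (a * z / 2) = 0 ↔ ∃ n, z = sinhPole a n := by
  have ha' : (a : ℂ) ≠ 0 := Complex.ofReal_ne_zero.2 ha
  have hsinh : Complex.sinh (a * z / 2) = 0 ↔ Complex.sin (a * z / 2 * Complex.I) = 0 := by
    simp [Complex.sin_mul_I]
  rw [mul_eq_zero, or_iff_right two_ne_zero, hsinh, Complex.sin_eq_zero_iff,
    (Equiv.neg ℤ).exists_congr_left]
  refine exists_congr fun n => ?_
  simp only [Equiv.neg_symm, Equiv.neg_apply, Int.cast_neg, sinhPole]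
  constructor <;> intro h
  · field_simp
    linear_combination (-2 * Complex.I) * h + (a * z : ℂ) * Complex.I_sq
  · subst h
    field_simp
    linear_combination (n : ℂ) * Complex.I_sq

theorem norm_sinhPole (ha : 0 < a) : ‖sinhPole a n‖ = 2 * Real.pi * |(n : ℝ)| / a := by
  simp [sinhPole, abs_of_pos ha, abs_of_pos Real.pi_pos]

theorem sinhPole_ne_zero (ha : a ≠ 0) (hn : n ≠ 0) : sinhPole a n ≠ 0 := by
  simp [sinhPole, ha, hn, Real.pi_ne_zero]

theorem sinhPole_right_injective (ha : a ≠ 0) : Function.Injective (sinhPole a) := fun m n h => by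
  simpa [sinhPole, ha, Real.pi_ne_zero] using h

theorem two_mul_sinh_sinhPole_ne_zero (hn : n ≠ 0) {b : ℝ} (hab : Irrational (b / a)) :
    2 * Complex.sinh (b * sinhPole a n / 2) ≠ 0 := by
  rw [two_mul_sinh_sinhPole]
  exact mul_ne_zero (mul_ne_zero two_ne_zero
    (Complex.ofReal_ne_zero.2 (sin_pi_mul_int_mul_ne_zero hab hn))) Complex.I_ne_zero

theorem hasDerivAt_two_mul_sinh_sinhPole (ha : a ≠ 0) :
    HasDerivAt (fun z : ℂ => 2 * Complex.sinh (a * z / 2)) (a * (-1) ^ n) (sinhPole a n) := by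
  have h : HasDerivAt (fun z : ℂ => a * z / 2) (a / 2 : ℂ) (sinhPole a n) := by
    simpa using ((hasDerivAt_id (sinhPole a n)).const_mul (a : ℂ)).div_const 2
  refine (h.csinh.const_mul 2).congr_deriv ?_
  rw [mul_sinhPole_div_two, Complex.cosh_mul_I, ← Complex.ofReal_cos, div_self ha, mul_one,
    mul_comm Real.pi, Real.cos_int_mul_pi]
  push_cast
  ring

theorem hasResidueAt_sinhKernel (ha : a ∈ s) (ha0 : a ≠ 0) (v : ℝ)
    (hirr : ∀ b ∈ s.erase a, Irrational (b / a)) (hn : n ≠ 0) :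
    HasResidueAt (sinhKernel s v) (sinhPole a n) (sinhResidue s v a n) := by
  set p := sinhPole a n with hp
  have ha' : (a : ℂ) ≠ 0 := Complex.ofReal_ne_zero.2 ha0
  have hden : p * ∏ b ∈ s.erase a, 2 * Complex.sinh (b * p / 2) ≠ 0 :=
    mul_ne_zero (sinhPole_ne_zero ha0 hn) (Finset.prod_ne_zero_iff.2 fun b hb =>
      two_mul_sinh_sinhPole_ne_zero hn (hirr b hb))
  have hres := HasResidueAt.of_hasDerivAt (p := p) (g := fun z : ℂ =>
      Complex.exp (v * z) / (z * ∏ b ∈ s.erase a, 2 * Complex.sinh (b * z / 2)))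
    (by fun_prop (disch := assumption)) (hasDerivAt_two_mul_sinh_sinhPole ha0)
    ((two_mul_sinh_eq_zero_iff ha0).2 ⟨n, rfl⟩)
    (mul_ne_zero ha' (zpow_ne_zero _ (neg_ne_zero.2 one_ne_zero)))
  convert hres using 1
  · ext z
    rw [sinhKernel, div_div, mul_assoc, Finset.prod_erase_mul _ _ ha]
  · have hexp : (v * p : ℂ) = (2 * Real.pi * n * (v / a) : ℝ) * Complex.I := by
      simp only [hp, sinhPole]
      push_cast
      ring
    have hprod : ∏ b ∈ s.erase a, 2 * Complex.sinh (b * p / 2) = Complex.I ^ (s.erase a).card *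
        ∏ b ∈ s.erase a, 2 * (Real.sin (Real.pi * (n * (b / a))) : ℂ) := by
      simp only [hp, two_mul_sinh_sinhPole, Finset.prod_mul_distrib, Finset.prod_const]
      ring
    rw [sinhResidue, hexp, div_div, hprod, hp, sinhPole, ← Finset.card_erase_add_one ha]
    congr 1
    generalize ∏ b ∈ s.erase a, 2 * (Real.sin (Real.pi * (n * (b / a))) : ℂ) = P
    field_simp
    ring

theorem sinhResidue_add_sinhResidue_neg (ha : a ∈ s) (v : ℝ) (k : ℕ) :
    sinhResidue s v a k + sinhResidue s v a (-k) = residuePair s v a k := by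
  have hcos : ∀ θ : ℝ, (Real.cos (θ - s.card * (Real.pi / 2)) : ℂ) =
      (Complex.exp (θ * Complex.I) / Complex.I ^ s.card +
        Complex.exp ((-θ : ℝ) * Complex.I) / (-Complex.I) ^ s.card) / 2 := fun θ => by
    have hI : Complex.I ^ s.card = Complex.exp (s.card * (Real.pi / 2 * Complex.I)) := by
      rw [Complex.exp_nat_mul, Complex.exp_pi_div_two_mul_I]
    rw [← Complex.inv_I, inv_pow, div_inv_eq_mul, hI, ← Complex.exp_sub, ← Complex.exp_add,
      Complex.ofReal_cos, Complex.cos]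
    push_cast
    ring_nf
  have hprod : ∏ b ∈ s.erase a, 2 * (Real.sin (Real.pi * ((-k : ℤ) * (b / a))) : ℂ) =
      (-1) ^ (s.erase a).card * ∏ b ∈ s.erase a, 2 * (Real.sin (Real.pi * (k * (b / a))) : ℂ) := by
    simp only [Int.cast_neg, Int.cast_natCast, neg_mul, mul_neg, Real.sin_neg, Complex.ofReal_neg,
      Finset.prod_neg]
  have hneg : 2 * Real.pi * (-k : ℤ) * (v / a) = -(2 * Real.pi * k * (v / a)) := by
    push_cast
    ring
  have hpow : (-Complex.I) ^ s.card = -(-1) ^ (s.erase a).card * Complex.I ^ s.card := by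
    rw [neg_pow, ← Finset.card_erase_add_one ha, pow_succ (-1 : ℂ), mul_neg_one]
  have hpair : (residuePair s v a k : ℂ) =
      (-1) ^ k * (Real.cos (2 * Real.pi * k * (v / a) - s.card * (Real.pi / 2)) : ℂ) /
        (Real.pi * k * ∏ b ∈ s.erase a, 2 * (Real.sin (Real.pi * (k * (b / a))) : ℂ)) := by
    rw [residuePair]
    push_cast
    rfl
  rw [sinhResidue, sinhResidue, hprod, hneg, hpair, hcos, hpow]
  simp only [Int.cast_natCast, Int.cast_neg, zpow_neg, zpow_natCast]
  rcases neg_one_pow_eq_or ℂ k with hk | hk <;>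
  rcases neg_one_pow_eq_or ℂ (s.erase a).card with hc | hc <;>
  · rw [hk, hc]
    ring

end Residues

section ResidueAtZero

theorem isLittleO_pow_of_lt {m n : ℕ} (h : m < n) (c : ℂ) :
    (fun z : ℂ => c * z ^ n) =o[𝓝[≠] 0] fun z => z ^ m :=
  ((Asymptotics.isLittleO_pow_pow h).mono nhdsWithin_le_nhds).const_mul_left c

theorem isLittleO_mul_sub_mul {f g p q : ℂ → ℂ} {n : ℕ}
    (hf : (fun z => f z - p z) =o[𝓝[≠] 0] fun z => z ^ n)
    (hg : (fun z => g z - q z) =o[𝓝[≠] 0] fun z => z ^ n)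
    (hp : ContinuousAt p 0) (hq : ContinuousAt q 0) :
    (fun z => f z * g z - p z * q z) =o[𝓝[≠] 0] fun z => z ^ n := by
  have hp' : p =O[𝓝[≠] 0] fun _ => (1 : ℂ) :=
    (hp.tendsto.mono_left nhdsWithin_le_nhds).isBigO_one ℂ
  have hq' : q =O[𝓝[≠] 0] fun _ => (1 : ℂ) :=
    (hq.tendsto.mono_left nhdsWithin_le_nhds).isBigO_one ℂ
  have hpow : (fun z : ℂ => z ^ n) =O[𝓝[≠] 0] fun _ => (1 : ℂ) := by
    have h : ContinuousAt (fun z : ℂ => z ^ n) 0 := by fun_prop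
    exact (h.tendsto.mono_left nhdsWithin_le_nhds).isBigO_one ℂ
  have hg' : g =O[𝓝[≠] 0] fun _ => (1 : ℂ) :=
    ((hg.isBigO.trans hpow).add hq').congr_left fun z => sub_add_cancel _ _
  have hfg : (fun z => (f z - p z) * g z) =o[𝓝[≠] 0] fun z => z ^ n := by
    simpa only [mul_one] using hf.mul_isBigO hg'
  have hpg : (fun z => p z * (g z - q z)) =o[𝓝[≠] 0] fun z => z ^ n := by
    simpa only [one_mul] using hp'.mul_isLittleO hg
  exact (hfg.add hpg).congr_left fun z => by ring

theorem isLittleO_exp_sub_sum (c : ℂ) (n : ℕ) :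
    (fun z => Complex.exp (c * z) - ∑ i ∈ Finset.range (n + 1), (c * z) ^ i / i.factorial)
      =o[𝓝[≠] 0] fun z => z ^ n := by
  have hz : Tendsto (fun z : ℂ => c * z) (𝓝[≠] 0) (𝓝 0) := by
    have h : ContinuousAt (fun z : ℂ => c * z) 0 := by fun_prop
    simpa using h.tendsto.mono_left nhdsWithin_le_nhds
  refine ((Complex.exp_sub_sum_range_succ_isLittleO_pow n).comp_tendsto hz).trans_isBigO ?_
  simpa only [Function.comp_def, mul_pow] using Asymptotics.isBigO_const_mul_self (c ^ n) _ _

theorem isLittleO_two_mul_sinh_div_sub (a : ℂ) :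
    (fun z => 2 * Complex.sinh (a * z / 2) / z - (a + a ^ 3 / 24 * z ^ 2))
      =o[𝓝[≠] 0] fun z => z ^ 3 := by
  have h := ((isLittleO_exp_sub_sum (a / 2) 4).sub (isLittleO_exp_sub_sum (-(a / 2)) 4)).mul_isBigO
    (Asymptotics.isBigO_refl (fun z : ℂ => z⁻¹) (𝓝[≠] 0))
  refine h.congr' ?_ ?_ <;> filter_upwards [self_mem_nhdsWithin] with z hz
  · have hz' : z ≠ 0 := hz
    rw [Complex.two_sinh, mul_div_right_comm, ← neg_mul]
    simp only [Finset.sum_range_succ, Finset.sum_range_zero, Nat.factorial]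
    push_cast
    field_simp
    ring
  · rw [pow_succ z 3, mul_inv_cancel_right₀ hz]

theorem isLittleO_div_two_mul_sinh_sub {a : ℂ} (ha : a ≠ 0) :
    (fun z => z / (2 * Complex.sinh (a * z / 2)) - a⁻¹ * (1 - a ^ 2 / 24 * z ^ 2))
      =o[𝓝[≠] 0] fun z => z ^ 3 := by
  set S : ℂ → ℂ := fun z => 2 * Complex.sinh (a * z / 2) / z with hS
  have hlim : Tendsto S (𝓝[≠] 0) (𝓝 a) := by
    have hpow : Tendsto (fun z : ℂ => z ^ 3) (𝓝[≠] 0) (𝓝 0) := by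
      have h : ContinuousAt (fun z : ℂ => z ^ 3) 0 := by fun_prop
      simpa using h.tendsto.mono_left nhdsWithin_le_nhds
    have hpoly : Tendsto (fun z : ℂ => a + a ^ 3 / 24 * z ^ 2) (𝓝[≠] 0) (𝓝 a) := by
      have h : ContinuousAt (fun z : ℂ => a + a ^ 3 / 24 * z ^ 2) 0 := by fun_prop
      simpa using h.tendsto.mono_left nhdsWithin_le_nhds
    simpa using ((isLittleO_two_mul_sinh_div_sub a).trans_tendsto hpow).add hpoly
  have hone : (fun z => S z * (a⁻¹ * (1 - a ^ 2 / 24 * z ^ 2)) - 1) =o[𝓝[≠] 0] fun z => z ^ 3 := by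
    have hq : (fun z : ℂ => a⁻¹ * (1 - a ^ 2 / 24 * z ^ 2) - a⁻¹ * (1 - a ^ 2 / 24 * z ^ 2))
        =o[𝓝[≠] 0] fun z => z ^ 3 := by
      simpa only [sub_self] using Asymptotics.isLittleO_zero _ _
    have hmul := isLittleO_mul_sub_mul (isLittleO_two_mul_sinh_div_sub a) hq
      (by fun_prop) (by fun_prop)
    refine (hmul.add (isLittleO_pow_of_lt (by norm_num : 3 < 4) (-(a ^ 4 / 576)))).congr_left
      fun z => ?_
    field_simp
    ring
  have hinv : (fun z => (S z)⁻¹) =O[𝓝[≠] 0] fun _ => (1 : ℂ) := (hlim.inv₀ ha).isBigO_one ℂ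
  refine (hinv.mul_isLittleO hone.neg_left).congr' ?_ (by simp only [one_mul]; rfl)
  filter_upwards [hlim.eventually_ne ha] with z hz
  have hSz : z / (2 * Complex.sinh (a * z / 2)) = (S z)⁻¹ := by rw [hS, inv_div]
  rw [hSz]
  field_simp
  ring

theorem isLittleO_prod_div_two_mul_sinh_sub {s : Finset ℝ} (hs : ∀ a ∈ s, a ≠ 0) :
    (fun z => ∏ a ∈ s, z / (2 * Complex.sinh (a * z / 2)) -
      (∏ a ∈ s, (a : ℂ))⁻¹ * (1 - (∑ a ∈ s, (a : ℂ) ^ 2) / 24 * z ^ 2))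
      =o[𝓝[≠] 0] fun z => z ^ 3 := by
  induction s using Finset.cons_induction with
  | empty => simp
  | cons a s ha ih =>
    simp only [Finset.mem_cons, forall_eq_or_imp] at hs
    have ha0 : (a : ℂ) ≠ 0 := Complex.ofReal_ne_zero.2 hs.1
    have hmul := isLittleO_mul_sub_mul (isLittleO_div_two_mul_sinh_sub ha0) (ih hs.2)
      (by fun_prop) (by fun_prop)
    simp only [Finset.prod_cons, Finset.sum_cons]
    refine (hmul.add (isLittleO_pow_of_lt (by norm_num : 3 < 4)
      ((a * ∏ b ∈ s, (b : ℂ))⁻¹ * (a ^ 2 / 24 * ((∑ b ∈ s, (b : ℂ) ^ 2) / 24))))).congr_left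
      fun z => ?_
    ring

theorem coeff_sum_C_mul_X_pow_mul {n : ℕ} (hn : n ≤ 3) (v σ : ℝ) :
    ((∑ i ∈ Finset.range 4, Polynomial.C (v ^ i / i.factorial) * Polynomial.X ^ i) *
      (1 - Polynomial.C σ * Polynomial.X ^ 2)).coeff n =
      (v ^ n - n * (n - 1) * σ * v ^ (n - 2)) / n.factorial := by
  have hcoeff : ∀ m ≤ 3, (∑ i ∈ Finset.range 4, Polynomial.C (v ^ i / i.factorial) *
      Polynomial.X ^ i : Polynomial ℝ).coeff m = v ^ m / m.factorial := fun m hm => by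
    simp only [Polynomial.finsetSum_coeff, Polynomial.coeff_C_mul_X_pow, Finset.sum_ite_eq,
      Finset.mem_range, Nat.lt_succ_of_le hm, if_true]
  rw [mul_sub, mul_one, ← mul_assoc, Polynomial.coeff_sub, Polynomial.coeff_mul_X_pow',
    Polynomial.coeff_mul_C, hcoeff n hn, hcoeff (n - 2) (by lia)]
  interval_cases n <;> norm_num [Nat.factorial] <;> ring

/-- The residue of `sinhKernel s v` at `0` when `s` has `n ≤ 3` elements. The factor `n (n - 1)`
vanishes when the exponent `n - 2` is truncated. -/
noncomputable def zeroResidue (s : Finset ℝ) (v : ℝ) : ℝ :=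
  (∏ a ∈ s, a)⁻¹ * ((v ^ s.card - s.card * (s.card - 1) * ((∑ a ∈ s, a ^ 2) / 24) *
    v ^ (s.card - 2)) / s.card.factorial)

theorem hasResidueAt_sinhKernel_zero {s : Finset ℝ} (hs : ∀ a ∈ s, a ≠ 0) (hcard : s.card ≤ 3)
    (v : ℝ) : HasResidueAt (sinhKernel s v) 0 (zeroResidue s v) := by
  set q : Polynomial ℝ := Polynomial.C (∏ a ∈ s, a)⁻¹ *
    ((∑ i ∈ Finset.range 4, Polynomial.C (v ^ i / i.factorial) * Polynomial.X ^ i) *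
      (1 - Polynomial.C ((∑ a ∈ s, a ^ 2) / 24) * Polynomial.X ^ 2)) with hq
  refine ⟨s.card, q.map Complex.ofRealHom, ?_, ?_⟩
  · have hmul := isLittleO_mul_sub_mul (isLittleO_exp_sub_sum v 3)
      (isLittleO_prod_div_two_mul_sinh_sub hs) (by fun_prop) (by fun_prop)
    have hpow : (fun z : ℂ => z ^ 3) =O[𝓝[≠] 0] fun z => z ^ s.card :=
      hcard.lt_or_eq.elim (fun h => (Asymptotics.isLittleO_pow_pow h).isBigO.mono
        nhdsWithin_le_nhds) fun h => h ▸ Asymptotics.isBigO_refl _ _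
    simp only [sub_zero]
    refine (hmul.trans_isBigO hpow).congr' ?_ EventuallyEq.rfl
    filter_upwards [self_mem_nhdsWithin] with z hz
    have hz' : z ≠ 0 := hz
    have heval : (q.map Complex.ofRealHom).eval z = (∏ a ∈ s, (a : ℂ))⁻¹ *
        ((∑ i ∈ Finset.range 4, (v * z) ^ i / i.factorial) *
          (1 - (∑ a ∈ s, (a : ℂ) ^ 2) / 24 * z ^ 2)) := by
      simp [hq, Polynomial.eval_finsetSum, Polynomial.map_sum, mul_pow, div_mul_eq_mul_div]
    rw [heval, sinhKernel, mul_div_assoc', pow_succ' z s.card, mul_assoc z,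
      mul_div_mul_left _ _ hz', Finset.prod_div_distrib, Finset.prod_const]
    ring
  · rw [Polynomial.coeff_map, hq, Polynomial.coeff_C_mul, coeff_sum_C_mul_X_pow_mul hcard,
      zeroResidue, Complex.ofRealHom_eq_coe]

end ResidueAtZero

section SumOfResidues

variable {s : Finset ℝ}

theorem sum_Icc_neg_erase_zero {M : Type*} [AddCommGroup M] (f : ℤ → M) (N : ℕ) :
    ∑ n ∈ (Finset.Icc (-N : ℤ) N).erase 0, f n = ∑ k ∈ Finset.Icc 1 N, (f k + f (-k)) := by
  rw [Finset.sum_erase_eq_sub (by simp), sub_eq_iff_eq_add]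
  induction N with
  | zero => simp
  | succ N ih =>
    rw [Finset.sum_Icc_succ_top (by lia), add_right_comm, ← ih]
    push_cast
    rw [Finset.sum_Icc_succ_eq_add_endpoints, add_comm]

theorem norm_sinhPole_le_iff {a : ℝ} (ha : 0 < a) {R : ℝ} (hR : 0 ≤ R) {n : ℤ} :
    ‖sinhPole a n‖ ≤ 2 * Real.pi * R ↔ n ∈ Finset.Icc (-⌊R * a⌋₊ : ℤ) ⌊R * a⌋₊ := by
  rw [norm_sinhPole ha, mul_div_assoc, mul_le_mul_iff_right₀ Real.two_pi_pos, div_le_iff₀ ha,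
    Finset.mem_Icc, ← abs_le, Int.abs_eq_natAbs, Nat.cast_le, Nat.le_floor_iff (by positivity),
    ← Int.cast_abs, Int.abs_eq_natAbs, Int.cast_natCast]

theorem norm_sinhPole_ne {a : ℝ} (ha : 0 < a) {R : ℝ}
    (hsin : Real.sin (a * (2 * Real.pi * R) / 2) ≠ 0) (n : ℤ) :
    ‖sinhPole a n‖ ≠ 2 * Real.pi * R := fun h =>
  two_mul_sinh_ne_zero_of_norm_eq ha hsin h ((two_mul_sinh_eq_zero_iff ha.ne').2 ⟨n, rfl⟩)

/-- The poles of `sinhKernel`: `none` stands for `0` and `⟨a, n⟩` with `n ≠ 0` for `2πin / a`. -/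
noncomputable def kernelPole (o : Option (Σ _ : ℝ, ℤ)) : ℂ :=
  o.elim 0 fun i => sinhPole i.1 i.2

/-- The indices of the poles of `sinhKernel s v` in the disc of radius `2πR`. -/
noncomputable def poleIndices (s : Finset ℝ) (R : ℝ) : Finset (Option (Σ _ : ℝ, ℤ)) :=
  Finset.insertNone (s.sigma fun a => (Finset.Icc (-⌊R * a⌋₊ : ℤ) ⌊R * a⌋₊).erase 0)

theorem forall_mem_poleIndices {R : ℝ} {p : Option (Σ _ : ℝ, ℤ) → Prop} :
    (∀ o ∈ poleIndices s R, p o) ↔ p none ∧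
      ∀ a ∈ s, ∀ n ∈ (Finset.Icc (-⌊R * a⌋₊ : ℤ) ⌊R * a⌋₊).erase 0, p (some ⟨a, n⟩) := by
  simp only [poleIndices, Finset.forall_mem_insertNone, Finset.mem_sigma, Sigma.forall, and_imp]
  exact and_congr_right fun _ => forall_congr' fun a => forall_comm

theorem injOn_kernelPole (hpos : ∀ a ∈ s, 0 < a)
    (hirr : (s : Set ℝ).Pairwise fun a b => Irrational (b / a)) (R : ℝ) :
    Set.InjOn kernelPole (poleIndices s R) := by
  have hne : ∀ a ∈ s, ∀ n ≠ 0, sinhPole a n ≠ 0 := fun a ha n => sinhPole_ne_zero (hpos a ha).ne'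
  suffices ∀ o ∈ poleIndices s R, ∀ o' ∈ poleIndices s R, kernelPole o = kernelPole o' → o = o' from
    fun o ho o' ho' h => this o ho o' ho' h
  simp only [forall_mem_poleIndices, kernelPole, Option.elim, Finset.mem_erase, and_imp]
  refine ⟨⟨fun _ => trivial, fun a ha n hn _ h => absurd h.symm (hne a ha n hn)⟩,
    fun a ha n hn _ => ⟨fun h => absurd h (hne a ha n hn), fun b hb m _ _ h => ?_⟩⟩
  obtain rfl | hab := eq_or_ne a b
  · rw [sinhPole_right_injective (hpos a ha).ne' h]
  · exact absurd ((two_mul_sinh_eq_zero_iff (hpos b hb).ne').2 ⟨m, h⟩)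
      (two_mul_sinh_sinhPole_ne_zero hn (hirr ha hb hab))

/-- The sum of the residues of `sinhKernel s v` in the disc of radius `2πR`, for `s` of at most
three elements. -/
noncomputable def residueSum (s : Finset ℝ) (v R : ℝ) : ℝ :=
  zeroResidue s v + ∑ a ∈ s, ∑ k ∈ Finset.Icc 1 ⌊R * a⌋₊, residuePair s v a k

theorem sum_residues_eq_residueSum (v R : ℝ) :
    ∑ o ∈ poleIndices s R, o.elim (zeroResidue s v : ℂ) (fun i => sinhResidue s v i.1 i.2) =
      residueSum s v R := by
  rw [poleIndices, Finset.sum_insertNone, Finset.sum_sigma, residueSum, Complex.ofReal_add,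
    Complex.ofReal_sum]
  refine congrArg _ (Finset.sum_congr rfl fun a ha => ?_)
  simp only [Option.elim_some, sum_Icc_neg_erase_zero, sinhResidue_add_sinhResidue_neg ha,
    Complex.ofReal_sum]

theorem kernelIntegral_eq_residueSum (hpos : ∀ a ∈ s, 0 < a)
    (hirr : (s : Set ℝ).Pairwise fun a b => Irrational (b / a)) (hcard : s.card ≤ 3) (v : ℝ)
    {R : ℝ} (hR : 0 < R) (hsin : ∀ a ∈ s, Real.sin (a * (2 * Real.pi * R) / 2) ≠ 0) :
    kernelIntegral s v (2 * Real.pi * R) = residueSum s v R := by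
  have hT : 0 < 2 * Real.pi * R := by positivity
  have hball : ∀ o ∈ poleIndices s R, kernelPole o ∈ Metric.ball 0 (2 * Real.pi * R) := by
    refine forall_mem_poleIndices.2 ⟨Metric.mem_ball_self hT, fun a ha n hn => ?_⟩
    rw [mem_ball_zero_iff]
    exact ((norm_sinhPole_le_iff (hpos a ha) hR.le).2 (Finset.mem_of_mem_erase hn)).lt_of_ne
      (norm_sinhPole_ne (hpos a ha) (hsin a ha) n)
  have hdiff : ∀ z ∈ Metric.closedBall 0 (2 * Real.pi * R),
      (∀ o ∈ poleIndices s R, z ≠ kernelPole o) → DifferentiableAt ℂ (sinhKernel s v) z := by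
    intro z hz hzP
    obtain ⟨hz0, hzP⟩ := forall_mem_poleIndices.1 hzP
    refine differentiableAt_sinhKernel hz0 fun a ha h => ?_
    obtain ⟨n, rfl⟩ := (two_mul_sinh_eq_zero_iff (hpos a ha).ne').1 h
    refine hzP a ha n (Finset.mem_erase.2 ⟨?_, ?_⟩) rfl
    · rintro rfl
      simp [sinhPole, kernelPole] at hz0
    · exact (norm_sinhPole_le_iff (hpos a ha) hR.le).1 (mem_closedBall_zero_iff.1 hz)
  have hres : ∀ o ∈ poleIndices s R, HasResidueAt (sinhKernel s v) (kernelPole o)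
      (o.elim (zeroResidue s v : ℂ) fun i => sinhResidue s v i.1 i.2) :=
    forall_mem_poleIndices.2 ⟨hasResidueAt_sinhKernel_zero (fun a ha => (hpos a ha).ne') hcard v,
      fun a ha n hn => hasResidueAt_sinhKernel ha (hpos a ha).ne' v
        (fun b hb => hirr ha (Finset.mem_of_mem_erase hb) (Finset.ne_of_mem_erase hb).symm)
        (Finset.ne_of_mem_erase hn)⟩
  rw [kernelIntegral, circleIntegral_eq_sum_residues hT _ (injOn_kernelPole hpos hirr R) hball hdiff
    hres, inv_mul_cancel_left₀ Complex.two_pi_I_ne_zero, sum_residues_eq_residueSum]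

end SumOfResidues

section ExplicitResidues

theorem residuePair_insert {a : ℝ} {t : Finset ℝ} (ha : a ∉ t) (v : ℝ) (k : ℕ) :
    residuePair (insert a t) v a k =
      (-1) ^ k * Real.cos (2 * Real.pi * k * (v / a) - (t.card + 1) * (Real.pi / 2)) /
        (Real.pi * k * ∏ b ∈ t, 2 * Real.sin (Real.pi * (k * (b / a)))) := by
  rw [residuePair, Finset.erase_insert ha, Finset.card_insert_of_notMem ha, Nat.cast_succ]

theorem residuePair_singleton (v a : ℝ) (k : ℕ) :
    residuePair {a} v a k =
      (-1) ^ k * Real.sin (2 * Real.pi * k * (v / a)) / (Real.pi * k) := by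
  simpa [Real.cos_sub_pi_div_two] using residuePair_insert (Finset.notMem_empty a) v k

theorem residuePair_pair {a b : ℝ} (hab : a ≠ b) (v : ℝ) (k : ℕ) :
    residuePair {a, b} v a k = -((-1) ^ k * Real.cos (2 * Real.pi * k * (v / a))) /
      (2 * Real.pi * k * Real.sin (Real.pi * (k * (b / a)))) := by
  have hshift : ∀ x, Real.cos (x - ((({b} : Finset ℝ).card : ℝ) + 1) * (Real.pi / 2)) =
      -Real.cos x := fun x => by
    rw [← Real.cos_sub_pi]
    push_cast [Finset.card_singleton]
    ring_nf
  rw [residuePair_insert (by simpa using hab), hshift, Finset.prod_singleton]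
  ring

theorem residuePair_triple {a b c : ℝ} (hab : a ≠ b) (hac : a ≠ c) (hbc : b ≠ c) (v : ℝ) (k : ℕ) :
    residuePair {a, b, c} v a k = -((-1) ^ k * Real.sin (2 * Real.pi * k * (v / a))) /
      (4 * Real.pi * k *
        (Real.sin (Real.pi * (k * (b / a))) * Real.sin (Real.pi * (k * (c / a))))) := by
  have hshift : ∀ x, Real.cos (x - ((({b, c} : Finset ℝ).card : ℝ) + 1) * (Real.pi / 2)) =
      -Real.sin x := fun x => by
    rw [← Real.cos_sub_pi_div_two, ← Real.cos_sub_pi]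
    push_cast [Finset.card_pair hbc]
    ring_nf
  rw [residuePair_insert (by simp [hab, hac]), hshift, Finset.prod_pair hbc]
  ring

theorem zeroResidue_singleton (v a : ℝ) : zeroResidue {a} v = v / a := by
  simp [zeroResidue, div_eq_inv_mul]

theorem zeroResidue_triple {a b c : ℝ} (hab : a ≠ b) (hac : a ≠ c) (hbc : b ≠ c) (v : ℝ) :
    zeroResidue {a, b, c} v =
      (v ^ 3 / 6 - v * (a ^ 2 + b ^ 2 + c ^ 2) / 24) / (a * b * c) := by
  have ha : a ∉ ({b, c} : Finset ℝ) := by simp [hab, hac]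
  rw [zeroResidue, Finset.card_insert_of_notMem ha, Finset.card_pair hbc, Finset.prod_insert ha,
    Finset.prod_pair hbc, Finset.sum_insert ha, Finset.sum_pair hbc]
  norm_num [Nat.factorial]
  ring

end ExplicitResidues

section LatticeCount

/-- The number of tuples of natural numbers `p` with `∑ i, p i * l i ≤ u`, where the tuples that
satisfy `∑ i, p i * l i = u` have weight `1 / 2`. -/
noncomputable def latticeCount : List ℝ → ℝ → ℝ
  | [], u => (1 + Real.sign u) / 2
  | a :: l, u => ∑' p : ℕ, latticeCount l (u - p * a)

theorem latticeCount_of_neg {l : List ℝ} (hpos : ∀ a ∈ l, 0 < a) {u : ℝ} (hu : u < 0) :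
    latticeCount l u = 0 := by
  induction l generalizing u with
  | nil => simp [latticeCount, Real.sign_of_neg hu]
  | cons a l ih =>
    simp only [List.mem_cons, forall_eq_or_imp] at hpos
    refine (tsum_congr fun p => ih hpos.2 ?_).trans tsum_zero
    have : 0 ≤ (p : ℝ) * a := mul_nonneg p.cast_nonneg hpos.1.le
    linarith

theorem summable_latticeCount {a : ℝ} {l : List ℝ} (hpos : ∀ b ∈ a :: l, 0 < b) (u : ℝ) :
    Summable fun p : ℕ => latticeCount l (u - p * a) := by
  simp only [List.mem_cons, forall_eq_or_imp] at hpos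
  obtain ⟨n, hn⟩ := exists_nat_gt (u / a)
  refine summable_of_ne_finset_zero (s := Finset.range n) fun p hp => latticeCount_of_neg hpos.2 ?_
  have hnp : (n : ℝ) ≤ p := by exact_mod_cast not_lt.1 (mt Finset.mem_range.2 hp)
  linarith [(div_lt_iff₀ hpos.1).1 (hn.trans_le hnp)]

theorem latticeCount_cons {a : ℝ} {l : List ℝ} (hpos : ∀ b ∈ a :: l, 0 < b) (u : ℝ) :
    latticeCount (a :: l) u = latticeCount l u + latticeCount (a :: l) (u - a) := by
  rw [latticeCount, (summable_latticeCount hpos u).tsum_eq_zero_add, latticeCount]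
  congr 1
  · simp
  · exact tsum_congr fun p => congrArg _ (by push_cast; ring)

/-- The limit of `kernelIntegral l.toFinset v` along radii that avoid the poles. -/
noncomputable def kernelLimit (l : List ℝ) (v : ℝ) : ℝ :=
  latticeCount l (v - l.sum / 2) + (-1) ^ l.length * latticeCount l (-v - l.sum / 2)

theorem kernelLimit_nil (v : ℝ) : kernelLimit [] v = 1 := by
  simp [kernelLimit, latticeCount, Real.sign_neg]
  ring

theorem kernelLimit_cons_sub {a : ℝ} {l : List ℝ} (hpos : ∀ b ∈ a :: l, 0 < b) (v : ℝ) :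
    kernelLimit (a :: l) (v + a / 2) - kernelLimit (a :: l) (v - a / 2) = kernelLimit l v := by
  have hright := latticeCount_cons hpos (v - l.sum / 2)
  have hleft := latticeCount_cons hpos (-v - l.sum / 2)
  simp only [kernelLimit, List.sum_cons, List.length_cons, pow_succ]
  rw [show v + a / 2 - (a + l.sum) / 2 = v - l.sum / 2 by ring,
    show -(v + a / 2) - (a + l.sum) / 2 = -v - l.sum / 2 - a by ring,
    show v - a / 2 - (a + l.sum) / 2 = v - l.sum / 2 - a by ring,
    show -(v - a / 2) - (a + l.sum) / 2 = -v - l.sum / 2 by ring, hright, hleft]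
  ring

theorem kernelLimit_of_abs_lt {l : List ℝ} (hpos : ∀ a ∈ l, 0 < a) {v : ℝ}
    (hv : |v| < l.sum / 2) : kernelLimit l v = 0 := by
  obtain ⟨hl, hr⟩ := abs_lt.1 hv
  rw [kernelLimit, latticeCount_of_neg hpos (by linarith), latticeCount_of_neg hpos (by linarith)]
  simp

theorem kernelLimit_of_neg_sum_div_two_lt {l : List ℝ} (hpos : ∀ a ∈ l, 0 < a) {v : ℝ}
    (hv : -(l.sum / 2) < v) : kernelLimit l v = latticeCount l (v - l.sum / 2) := by
  rw [kernelLimit, latticeCount_of_neg hpos (u := -v - _) (by linarith)]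
  simp

theorem kernelLimit_singleton_half {a : ℝ} (ha : 0 < a) : kernelLimit [a] (a / 2) = 1 / 2 := by
  have hpos : ∀ b ∈ [a], 0 < b := by simpa using ha
  have hsum : [a].sum = a := List.sum_singleton
  rw [kernelLimit_of_neg_sum_div_two_lt hpos (by linarith), hsum, sub_self, latticeCount_cons hpos,
    latticeCount_of_neg hpos (by linarith)]
  simp [latticeCount]

theorem kernelIntegral_singleton_half {a R : ℝ} (ha : 0 < a) (hR : 0 < R)
    (hsin : Real.sin (a * (2 * Real.pi * R) / 2) ≠ 0) :
    kernelIntegral {a} (a / 2) (2 * Real.pi * R) = 1 / 2 := by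
  have hpair : ∀ k : ℕ, residuePair {a} (a / 2) a k = 0 := fun k => by
    rw [residuePair_singleton, show 2 * Real.pi * k * (a / 2 / a) = k * Real.pi by field_simp,
      Real.sin_nat_mul_pi, mul_zero, zero_div]
  rw [kernelIntegral_eq_residueSum (by simpa using ha) (by simp) (by simp) _ hR
    (by simpa using hsin), residueSum, Finset.sum_singleton,
    Finset.sum_eq_zero fun k _ => hpair k, zeroResidue_singleton, add_zero,
    div_div_cancel_left' ha.ne']
  norm_num

variable {R : ℕ → ℝ}

theorem tendsto_kernelIntegral_periodic {a : ℝ} {l : List ℝ} (hal : a ∉ l)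
    (hpos : ∀ b ∈ a :: l, 0 < b) (hR : Tendsto R atTop atTop)
    (hav : AvoidsPoles R (a :: l).toFinset)
    (ih : ∀ v, Tendsto (fun j => kernelIntegral l.toFinset v (2 * Real.pi * R j)) atTop
      (𝓝 (kernelLimit l v : ℂ))) :
    Function.Periodic (fun v => Tendsto
      (fun j => kernelIntegral (a :: l).toFinset v (2 * Real.pi * R j)) atTop
      (𝓝 (kernelLimit (a :: l) v : ℂ))) a := fun v => by
  have hstep : ∀ᶠ j in atTop, kernelIntegral (a :: l).toFinset (v + a) (2 * Real.pi * R j) =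
      kernelIntegral (a :: l).toFinset v (2 * Real.pi * R j) +
        kernelIntegral l.toFinset (v + a / 2) (2 * Real.pi * R j) := by
    filter_upwards [hR.eventually_gt_atTop 0] with j hj
    rw [List.toFinset_cons] at hav ⊢
    rw [← kernelIntegral_insert_sub (by simpa using hal) (by simpa using hpos) (v + a / 2)
      (by positivity) (hav.sin_ne_zero j)]
    ring_nf
  have hlim : kernelLimit (a :: l) (v + a) =
      kernelLimit (a :: l) v + kernelLimit l (v + a / 2) := by
    rw [← kernelLimit_cons_sub hpos (v + a / 2)]
    ring_nf
  refine propext ((tendsto_congr' hstep).trans ?_)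
  rw [hlim, Complex.ofReal_add]
  refine ⟨fun h => ?_, fun h => h.add (ih _)⟩
  simpa using h.sub (ih (v + a / 2))

theorem tendsto_kernelIntegral_of_mem_Ioc {a : ℝ} {l : List ℝ} (hl : (a :: l).Nodup)
    (hpos : ∀ b ∈ a :: l, 0 < b) (hR : Tendsto R atTop atTop)
    (hav : AvoidsPoles R (a :: l).toFinset) {v : ℝ} (hv : v ∈ Set.Ioc (-(a / 2)) (a / 2)) :
    Tendsto (fun j => kernelIntegral (a :: l).toFinset v (2 * Real.pi * R j)) atTop
      (𝓝 (kernelLimit (a :: l) v : ℂ)) := by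
  by_cases hlt : |v| < (a :: l).sum / 2
  · rw [kernelLimit_of_abs_lt hpos hlt, Complex.ofReal_zero]
    refine tendsto_kernelIntegral_zero (by simpa using hpos) (hlt.trans_eq ?_) hR hav
    rw [← Finset.sum_div, List.sum_toFinset _ hl, List.map_id']
  · simp only [List.mem_cons, forall_eq_or_imp] at hpos
    have hva : |v| ≤ a / 2 := abs_le.2 ⟨hv.1.le, hv.2⟩
    rw [not_lt, List.sum_cons] at hlt
    obtain rfl : l = [] := by
      by_contra hne
      linarith [List.sum_pos l hpos.2 hne]
    obtain rfl : v = a / 2 := by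
      rw [List.sum_nil, add_zero] at hlt
      exact ((abs_eq (by linarith [hpos.1])).1 (hva.antisymm hlt)).resolve_right hv.1.ne'
    refine tendsto_const_nhds.congr' ?_
    filter_upwards [hR.eventually_gt_atTop 0] with j hj
    rw [kernelLimit_singleton_half hpos.1, List.toFinset_cons, List.toFinset_nil, insert_empty_eq,
      kernelIntegral_singleton_half hpos.1 hj (hav.sin_ne_zero j a (by simp))]
    norm_num

theorem tendsto_kernelIntegral {l : List ℝ} (hl : l.Nodup) (hpos : ∀ a ∈ l, 0 < a)
    (hR : Tendsto R atTop atTop) (hav : AvoidsPoles R l.toFinset) (v : ℝ) :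
    Tendsto (fun j => kernelIntegral l.toFinset v (2 * Real.pi * R j)) atTop
      (𝓝 (kernelLimit l v : ℂ)) := by
  induction l generalizing v with
  | nil =>
    refine tendsto_const_nhds.congr' ?_
    filter_upwards [hR.eventually_gt_atTop 0] with j hj
    rw [List.toFinset_nil, kernelIntegral_empty _ (by positivity), kernelLimit_nil,
      Complex.ofReal_one]
  | cons a l ih =>
    obtain ⟨hal, hl'⟩ := List.nodup_cons.1 hl
    have hper := tendsto_kernelIntegral_periodic hal hpos hR hav
      (ih hl' (fun b hb => hpos b (List.mem_cons_of_mem a hb)) (hav.mono (by simp)))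
    obtain ⟨w, hw, hvw⟩ := hper.exists_mem_Ioc (hpos a List.mem_cons_self) v (-(a / 2))
    rw [show -(a / 2) + a = a / 2 by ring] at hw
    exact hvw.mpr (tendsto_kernelIntegral_of_mem_Ioc hl hpos hR hav hw)

theorem tendsto_residueSum {l : List ℝ} (hl : l.Nodup) (hcard : l.length ≤ 3)
    (hpos : ∀ a ∈ l, 0 < a)
    (hirr : (l.toFinset : Set ℝ).Pairwise fun a b => Irrational (b / a))
    (hR : Tendsto R atTop atTop) (hav : AvoidsPoles R l.toFinset) (v : ℝ) :
    Tendsto (fun j => residueSum l.toFinset v (R j)) atTop (𝓝 (kernelLimit l v)) := by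
  rw [Complex.isUniformEmbedding_ofReal.isEmbedding.tendsto_nhds_iff]
  refine (tendsto_kernelIntegral hl hpos hR hav v).congr' ?_
  filter_upwards [hR.eventually_gt_atTop 0] with j hj
  exact kernelIntegral_eq_residueSum (by simpa using hpos) hirr
    (l.toFinset_card_le.trans hcard) v hj (hav.sin_ne_zero j)

end LatticeCount

section Radii

theorem two_mul_abs_sub_round_le_abs_sin (x : ℝ) :
    2 * |x - round x| ≤ |Real.sin (Real.pi * x)| := by
  have hsin : |Real.sin (Real.pi * x)| = |Real.sin (Real.pi * (x - round x))| := by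
    rw [mul_sub, mul_comm Real.pi (round x : ℝ), Real.sin_sub_int_mul_pi, abs_mul, abs_zpow,
      abs_neg, abs_one, one_zpow, one_mul]
  have hle : |Real.pi * (x - round x)| ≤ Real.pi / 2 := by
    rw [abs_mul, abs_of_pos Real.pi_pos]
    nlinarith [Real.pi_pos, abs_sub_round x]
  have hjordan := Real.mul_abs_le_abs_sin hle
  rwa [abs_mul, abs_of_pos Real.pi_pos, ← mul_assoc, div_mul_cancel₀ _ Real.pi_ne_zero,
    ← hsin] at hjordan

theorem half_le_abs_mul_sub_of_lt {a d r : ℝ} {n m m' : ℕ} {k k' : ℤ} (had : 0 < d * a)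
    (hn : (n + 1) * (d * a) ≤ 1) (hmm : m < m') (hm' : m' ≤ n)
    (hk : |(r + m * d) * a - k| < d * a / 2) : d * a / 2 ≤ |(r + m' * d) * a - k'| := by
  by_contra! hk'
  have hone : ((m : ℝ) + 1) ≤ m' := by exact_mod_cast hmm
  have hm'n : (m' : ℝ) ≤ n := by exact_mod_cast hm'
  have hm0 : (0 : ℝ) ≤ m := m.cast_nonneg
  rw [abs_lt] at hk hk'
  have hpos : (k : ℝ) < k' := by nlinarith [hk.2, hk'.1]
  have hlt : (k' : ℝ) < k + 1 := by nlinarith [hk.1, hk'.2]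
  norm_cast at hpos hlt
  lia

theorem exists_forall_half_le_abs_sub {s : Finset ℝ} {d : ℝ} (hd : 0 < d) (hs : ∀ a ∈ s, 0 < a)
    (hsd : ∀ a ∈ s, (s.card + 1) * (d * a) ≤ 1) (r : ℝ) :
    ∃ m : ℕ, ∀ a ∈ s, ∀ k : ℤ, d * a / 2 ≤ |(r + m * d) * a - k| := by
  by_contra! hnear
  choose f hfs k hk using hnear
  obtain ⟨m, hm, m', hm', hne, hff⟩ := Finset.exists_ne_map_eq_of_card_lt_of_maps_to
    (s := Finset.range (s.card + 1)) (t := s) (f := f) (by simp) fun m _ => hfs m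
  wlog hlt : m < m' generalizing m m'
  · exact this m' hm' m hm hne.symm hff.symm (hne.symm.lt_of_le (not_lt.1 hlt))
  exact half_le_abs_mul_sub_of_lt (mul_pos hd (hs _ (hfs m))) (hsd _ (hfs m)) hlt
    (Nat.lt_succ_iff.1 (Finset.mem_range.1 hm')) (hk m)
    |>.not_gt (hff ▸ hk m')

theorem exists_tendsto_avoidsPoles {s : Finset ℝ} (hs : ∀ a ∈ s, 0 < a) :
    ∃ R : ℕ → ℝ, Tendsto R atTop atTop ∧ AvoidsPoles R s := by
  have hsmall : ∀ᶠ d in 𝓝[>] (0 : ℝ), ∀ a ∈ s, d ≤ a ∧ (s.card + 1) * (d * a) ≤ 1 := by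
    refine (Finset.eventually_all s).2 fun a ha => nhdsWithin_le_nhds ?_
    have hlim : Tendsto (fun d : ℝ => (s.card + 1) * (d * a)) (𝓝 0) (𝓝 0) := by
      have : Continuous fun d : ℝ => (s.card + 1) * (d * a) := by fun_prop
      simpa using this.tendsto 0
    exact (eventually_le_nhds (hs a ha)).and (hlim.eventually_le_const one_pos)
  obtain ⟨d, hda, hd : 0 < d⟩ := (hsmall.and self_mem_nhdsWithin).exists
  choose m hm using fun j : ℕ => exists_forall_half_le_abs_sub hd hs (fun a ha => (hda a ha).2) j
  refine ⟨fun j => j + m j * d, tendsto_atTop_mono (fun j => le_add_of_nonneg_right (by positivity))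
    tendsto_natCast_atTop_atTop, d * d, by positivity, fun j a ha => ?_⟩
  calc d * d ≤ 2 * (d * a / 2) := by nlinarith [(hda a ha).1]
    _ ≤ 2 * |(j + m j * d) * a - round ((j + m j * d) * a)| := by gcongr; exact hm j a ha _
    _ ≤ |Real.sin (Real.pi * ((j + m j * d) * a))| := two_mul_abs_sub_round_le_abs_sin _
    _ = |Real.sin (a * (2 * Real.pi * (j + m j * d)) / 2)| := by ring_nf

end Radii

section Counting

theorem latticeCount_singleton_add_nat_mul {a w : ℝ} (ha : 0 < a) (hw : 0 ≤ w) (n : ℕ) :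
    latticeCount [a] (w + n * a) = latticeCount [a] w + n := by
  induction n with
  | zero => simp
  | succ n ih =>
    have hpos : 0 < w + (n + 1 : ℕ) * a := by positivity
    rw [latticeCount_cons (by simpa using ha),
      show w + (n + 1 : ℕ) * a - a = w + n * a by push_cast; ring, ih, latticeCount,
      Real.sign_of_pos hpos]
    push_cast
    ring

theorem latticeCount_singleton {a u : ℝ} (ha : 0 < a) (hu : 0 ≤ u) :
    latticeCount [a] u = u / a + 1 / 2 - bernoulliOneStar (u / a) := by
  have hpos : ∀ b ∈ [a], 0 < b := by simpa using ha
  have hfract : Int.fract (u / a) + ⌊u / a⌋₊ = u / a := by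
    rw [natCast_floor_eq_intCast_floor (div_nonneg hu ha.le), Int.fract_add_floor]
  have hdecomp : u = Int.fract (u / a) * a + ⌊u / a⌋₊ * a := by
    rw [← add_mul, hfract, div_mul_cancel₀ _ ha.ne']
  have hbelow : Int.fract (u / a) * a - a < 0 := by
    nlinarith [Int.fract_lt_one (u / a)]
  have hcount : latticeCount [a] u =
      (1 + Real.sign (Int.fract (u / a) * a)) / 2 + ⌊u / a⌋₊ := by
    conv_lhs => rw [hdecomp]
    rw [latticeCount_singleton_add_nat_mul ha (mul_nonneg (Int.fract_nonneg _) ha.le),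
      latticeCount_cons hpos, latticeCount_of_neg hpos hbelow, add_zero, latticeCount]
  rw [hcount, bernoulliOneStar]
  split_ifs with hint
  · have hzero : Int.fract (u / a) = 0 := Int.fract_eq_zero_iff.2 hint
    rw [hzero, zero_add] at hfract
    rw [hzero, zero_mul, Real.sign_zero, hfract]
    ring
  · have hne : Int.fract (u / a) ≠ 0 := fun h => hint (Int.fract_eq_zero_iff.1 h)
    rw [Real.sign_of_pos (mul_pos ((Int.fract_nonneg _).lt_of_ne' hne) ha)]
    linarith

theorem finite_setOf_add_le {a b c : ℝ} (ha : 0 < a) (hb : 0 < b) (hc : 0 < c) (u : ℝ) :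
    {t : ℕ × ℕ × ℕ | t.1 * a + t.2.1 * b + t.2.2 * c ≤ u}.Finite := by
  refine ((Set.finite_Iic ⌊u / a⌋₊).prod
    ((Set.finite_Iic ⌊u / b⌋₊).prod (Set.finite_Iic ⌊u / c⌋₊))).subset ?_
  rintro ⟨p, q, r⟩ (h : p * a + q * b + r * c ≤ u)
  have hp : 0 ≤ p * a := by positivity
  have hq : 0 ≤ q * b := by positivity
  have hr : 0 ≤ r * c := by positivity
  refine ⟨Nat.le_floor ?_, Nat.le_floor ?_, Nat.le_floor ?_⟩
  · exact (le_div_iff₀ ha).2 (by linarith)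
  · exact (le_div_iff₀ hb).2 (by linarith)
  · exact (le_div_iff₀ hc).2 (by linarith)

theorem one_add_sign_sub_div_two (u w : ℝ) [Decidable (w ≤ u)] [Decidable (w = u)] :
    (1 + Real.sign (u - w)) / 2 =
      (if w ≤ u then 1 else 0) - 1 / 2 * if w = u then 1 else 0 := by
  rcases lt_trichotomy w u with h | rfl | h
  · rw [Real.sign_of_pos (sub_pos.2 h), if_pos h.le, if_neg h.ne]
    norm_num
  · simp
    norm_num
  · rw [Real.sign_of_neg (sub_neg.2 h), if_neg h.not_ge, if_neg h.ne']
    norm_num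

theorem latticeCount_triple {a b c : ℝ} (ha : 0 < a) (hb : 0 < b) (hc : 0 < c) (u : ℝ) :
    latticeCount [a, b, c] u =
      ({t : ℕ × ℕ × ℕ | t.1 * a + t.2.1 * b + t.2.2 * c ≤ u}.ncard : ℝ) -
        1 / 2 * {t : ℕ × ℕ × ℕ | t.1 * a + t.2.1 * b + t.2.2 * c = u}.ncard := by
  classical
  have hfin := finite_setOf_add_le ha hb hc u
  set f : ℕ × ℕ × ℕ → ℝ := fun t => t.1 * a + t.2.1 * b + t.2.2 * c with hf
  have hterm := fun t => one_add_sign_sub_div_two u (f t)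
  have hzero : ∀ t ∉ hfin.toFinset, (1 + Real.sign (u - f t)) / 2 = 0 := fun t ht => by
    have hlt : u < f t := by simpa [hf] using ht
    simp [hterm, hlt.not_ge, hlt.ne']
  have hsum : Summable fun t => (1 + Real.sign (u - f t)) / 2 := summable_of_ne_finset_zero hzero
  have htsum : latticeCount [a, b, c] u = ∑' t, (1 + Real.sign (u - f t)) / 2 := by
    rw [hsum.tsum_prod]
    refine tsum_congr fun p => ?_
    rw [(hsum.prod_factor p).tsum_prod]
    simp only [latticeCount, hf, ← sub_sub]
  have heq : {t | f t = u} = ↑(hfin.toFinset.filter fun t => f t = u) := by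
    ext t
    simpa [hf] using fun h => le_of_eq h
  rw [htsum, tsum_eq_sum hzero, heq, Set.ncard_coe_finset, Set.ncard_eq_toFinset_card _ hfin]
  simp only [hterm, Finset.sum_sub_distrib, ← Finset.mul_sum, Finset.sum_boole]
  rw [Finset.filter_true_of_mem (by simp [hf])]

theorem eq_of_pow_mul_eq_pow_mul {a m m' p p' : ℕ} (ha : 1 < a) (hm : a.Coprime m)
    (hm' : a.Coprime m') (h : a ^ p * m = a ^ p' * m') : p = p' ∧ m = m' := by
  have hle : ∀ {p p' m m' : ℕ}, a.Coprime m' → a ^ p * m = a ^ p' * m' → p ≤ p' :=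
    fun hm' h => (Nat.pow_dvd_pow_iff_le_right ha).1
      ((hm'.pow_left _).dvd_of_dvd_mul_right (h ▸ dvd_mul_right _ _))
  obtain rfl := (hle hm' h).antisymm (hle hm h.symm)
  exact ⟨rfl, Nat.eq_of_mul_eq_mul_left (pow_pos (by lia) _) h⟩

theorem irrational_log_div_log {a b : ℕ} (ha : 1 < a) (hb : 1 < b) (hab : a.Coprime b) :
    Irrational (Real.log b / Real.log a) := by
  have hla : 0 < Real.log a := Real.log_pos (by exact_mod_cast ha)
  have hlb : 0 < Real.log b := Real.log_pos (by exact_mod_cast hb)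
  rintro ⟨q, hq⟩
  have hq0 : 0 ≤ q := by
    exact_mod_cast hq ▸ (div_pos hlb hla).le
  have hlog : q.den * Real.log b = q.num.toNat * Real.log a := by
    have hnum : ((q.num.toNat : ℤ) : ℝ) = q.num := by
      rw [Int.toNat_of_nonneg (Rat.num_nonneg.2 hq0)]
    rw [Rat.cast_def, ← hnum, Int.cast_natCast, div_eq_div_iff (by simp) hla.ne'] at hq
    linarith
  rw [← Real.log_pow, ← Real.log_pow] at hlog
  have hpow : b ^ q.den = a ^ q.num.toNat := by
    exact_mod_cast Real.log_injOn_pos (Set.mem_Ioi.2 (by positivity))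
      (Set.mem_Ioi.2 (by positivity)) hlog
  have hself : (b ^ q.den).Coprime (b ^ q.den) := by
    conv_lhs => rw [hpow]
    exact hab.pow _ _
  exact hb.ne' ((Nat.pow_eq_one.1 ((Nat.coprime_self _).1 hself)).resolve_right q.den_nz)

section Smooth

variable {a b c : ℕ}

theorem injective_pow_mul_pow_mul_pow (ha : 1 < a) (hb : 1 < b) (hc : 1 < c)
    (hab : a.Coprime b) (hac : a.Coprime c) (hbc : b.Coprime c) :
    Function.Injective fun t : ℕ × ℕ × ℕ => a ^ t.1 * b ^ t.2.1 * c ^ t.2.2 := by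
  rintro ⟨p, q, r⟩ ⟨p', q', r'⟩ h
  simp only [mul_assoc] at h
  have hcop : ∀ q r, a.Coprime (b ^ q * c ^ r) := fun q r =>
    (hab.pow_right q).mul_right (hac.pow_right r)
  obtain ⟨rfl, hqr⟩ := eq_of_pow_mul_eq_pow_mul ha (hcop q r) (hcop q' r') h
  obtain ⟨rfl, hr⟩ := eq_of_pow_mul_eq_pow_mul hb (hbc.pow_right r) (hbc.pow_right r') hqr
  rw [Nat.pow_right_injective hc hr]

theorem log_pow_mul_pow_mul_pow (ha : 0 < a) (hb : 0 < b) (hc : 0 < c) (t : ℕ × ℕ × ℕ) :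
    Real.log ((a : ℝ) ^ t.1 * b ^ t.2.1 * c ^ t.2.2) =
      t.1 * Real.log a + t.2.1 * Real.log b + t.2.2 * Real.log c := by
  rw [Real.log_mul (by positivity) (by positivity), Real.log_mul (by positivity) (by positivity),
    Real.log_pow, Real.log_pow, Real.log_pow]

theorem smoothChi_eq_ncard (hinj : Function.Injective fun t : ℕ × ℕ × ℕ =>
    a ^ t.1 * b ^ t.2.1 * c ^ t.2.2) (x : ℝ) : smoothChi a b c x =
      {t : ℕ × ℕ × ℕ | (a : ℝ) ^ t.1 * (b : ℝ) ^ t.2.1 * (c : ℝ) ^ t.2.2 = x}.ncard := by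
  rw [smoothChi]
  split_ifs with h
  · obtain ⟨-, ⟨p, q, r, rfl⟩, rfl⟩ := h
    suffices hset : {t : ℕ × ℕ × ℕ | (a : ℝ) ^ t.1 * (b : ℝ) ^ t.2.1 * (c : ℝ) ^ t.2.2 =
        ((a ^ p * b ^ q * c ^ r : ℕ) : ℝ)} = {(p, q, r)} by
      rw [hset, Set.ncard_singleton, Nat.cast_one]
    refine Set.eq_singleton_iff_unique_mem.2 ⟨by simp, fun t ht => hinj ?_⟩
    exact_mod_cast ht
  · rw [Set.eq_empty_of_forall_notMem (s := {t : ℕ × ℕ × ℕ | _}) fun t ht => h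
      ⟨_, ⟨t.1, t.2.1, t.2.2, rfl⟩, by exact_mod_cast ht⟩, Set.ncard_empty, Nat.cast_zero]

theorem latticeCount_log (ha : 1 < a) (hb : 1 < b) (hc : 1 < c) (hab : a.Coprime b)
    (hac : a.Coprime c) (hbc : b.Coprime c) {x : ℝ} (hx : 0 < x) :
    latticeCount [Real.log a, Real.log b, Real.log c] (Real.log x) =
      smoothCount a b c x - 1 / 2 * smoothChi a b c x := by
  have hpos : ∀ t : ℕ × ℕ × ℕ, 0 < (a : ℝ) ^ t.1 * (b : ℝ) ^ t.2.1 * (c : ℝ) ^ t.2.2 :=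
    fun t => by positivity
  rw [latticeCount_triple (Real.log_pos (by exact_mod_cast ha))
      (Real.log_pos (by exact_mod_cast hb)) (Real.log_pos (by exact_mod_cast hc)),
    smoothChi_eq_ncard (injective_pow_mul_pow_mul_pow ha hb hc hab hac hbc), smoothCount]
  simp only [← log_pow_mul_pow_mul_pow (zero_lt_one.trans ha) (zero_lt_one.trans hb)
    (zero_lt_one.trans hc), Real.log_le_log_iff (hpos _) hx,
    Real.log_injOn_pos.eq_iff (Set.mem_Ioi.2 (hpos _)) (Set.mem_Ioi.2 hx)]

end Smooth

end Counting

section LogResidues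

theorem neg_one_pow_mul_cos_sub_half {a : ℝ} (ha : a ≠ 0) (u : ℝ) (k : ℕ) :
    (-1) ^ k * Real.cos (2 * Real.pi * k * ((u - a / 2) / a)) =
      Real.cos (2 * Real.pi * k * (u / a)) := by
  rw [← Real.cos_add_nat_mul_pi]
  congr 1
  field_simp
  ring

theorem neg_one_pow_mul_sin_add_half {a : ℝ} (ha : a ≠ 0) (u : ℝ) (k : ℕ) :
    (-1) ^ k * Real.sin (2 * Real.pi * k * ((u + a / 2) / a)) =
      Real.sin (2 * Real.pi * k * (u / a)) := by
  have hshift : 2 * Real.pi * k * ((u + a / 2) / a) =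
      2 * Real.pi * k * (u / a) + k * Real.pi := by
    field_simp
  rw [hshift, Real.sin_add_nat_mul_pi, ← mul_assoc, ← mul_pow, neg_one_mul, neg_neg, one_pow,
    one_mul]

theorem sin_add_add_div_sin_mul_sin {φ ψ : ℝ} (hφ : Real.sin φ ≠ 0) (hψ : Real.sin ψ ≠ 0)
    (θ : ℝ) :
    Real.sin (θ + φ + ψ) / (Real.sin φ * Real.sin ψ) =
      Real.cos (θ - φ) / Real.sin φ + Real.cos (θ - ψ) / Real.sin ψ - 4 * Real.sin θ +
        (Real.sin (θ + φ - ψ) + Real.sin (θ - φ + ψ)) / (2 * (Real.sin φ * Real.sin ψ)) := by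
  simp only [Real.sin_add, Real.sin_sub, Real.cos_add, Real.cos_sub]
  field_simp
  ring

theorem zeroResidue_triple_add_half {a b c : ℝ} (ha : 0 < a) (hb : 0 < b) (hc : 0 < c)
    (hab : a ≠ b) (hac : a ≠ c) (hbc : b ≠ c) (u : ℝ) :
    zeroResidue {a, b, c} (u + (a + b + c) / 2) =
      u ^ 3 / (6 * a * b * c) + u ^ 2 / (4 * a * b) + u ^ 2 / (4 * a * c) + u ^ 2 / (4 * b * c)
        + u / (4 * a) + u / (4 * b) + u / (4 * c)
        + a * u / (12 * b * c) + b * u / (12 * a * c) + c * u / (12 * a * b)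
        + a / (24 * b) + a / (24 * c) + b / (24 * a) + b / (24 * c) + c / (24 * a) + c / (24 * b)
        + 1 / 8 := by
  rw [zeroResidue_triple hab hac hbc]
  field_simp
  ring

variable {a b c : ℕ}

theorem log_ne_log_of_coprime (ha : 1 < a) (hb : 1 < b) (hab : a.Coprime b) :
    Real.log a ≠ Real.log b := fun h =>
  (irrational_log_div_log ha hb hab).ne_one
    (by rw [← h, div_self (Real.log_pos (by exact_mod_cast ha)).ne'])

theorem sin_pi_mul_log_div_log_ne_zero (ha : 1 < a) (hb : 1 < b) (hab : a.Coprime b) {k : ℕ}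
    (hk : k ≠ 0) : Real.sin (Real.pi * k * Real.log b / Real.log a) ≠ 0 := by
  have hsin := sin_pi_mul_int_mul_ne_zero (irrational_log_div_log ha hb hab)
    (Int.natCast_ne_zero.2 hk)
  rwa [Int.cast_natCast, ← mul_assoc, mul_div_assoc'] at hsin

theorem residuePair_log_pair (ha : 1 < a) (hb : 1 < b) (hab : a.Coprime b) (x : ℝ) (k : ℕ) :
    residuePair {Real.log a, Real.log b} (Real.log x - (Real.log a + Real.log b) / 2)
      (Real.log a) k = -(1 / (2 * Real.pi) * cosTerm a b x k) := by
  have hla : Real.log a ≠ 0 := (Real.log_pos (by exact_mod_cast ha)).ne'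
  rw [residuePair_pair (log_ne_log_of_coprime ha hb hab),
    show Real.log x - (Real.log a + Real.log b) / 2 =
      Real.log x - 1 / 2 * Real.log b - Real.log a / 2 by ring,
    neg_one_pow_mul_cos_sub_half hla, cosTerm]
  ring_nf

theorem residuePair_log_triple (ha : 1 < a) (hb : 1 < b) (hc : 1 < c) (hab : a.Coprime b)
    (hac : a.Coprime c) (hbc : b.Coprime c) (x : ℝ) {k : ℕ} (hk : k ≠ 0) :
    residuePair {Real.log a, Real.log b, Real.log c}
        (Real.log x + (Real.log a + Real.log b + Real.log c) / 2) (Real.log a) k =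
      residuePair {Real.log a} (Real.log x + Real.log a / 2) (Real.log a) k -
        1 / (4 * Real.pi) * (cosTerm a b x k + cosTerm a c x k) -
        1 / (8 * Real.pi) * sinTerm a b c x k := by
  have hla : Real.log a ≠ 0 := (Real.log_pos (by exact_mod_cast ha)).ne'
  set θ := 2 * Real.pi * k * (Real.log x / Real.log a) with hθ
  set φ := Real.pi * k * Real.log b / Real.log a with hφ
  set ψ := Real.pi * k * Real.log c / Real.log a with hψ
  have hadd := sin_add_add_div_sin_mul_sin (sin_pi_mul_log_div_log_ne_zero ha hb hab hk)
    (sin_pi_mul_log_div_log_ne_zero ha hc hac hk) θ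
  have hcosb : cosTerm a b x k = Real.cos (θ - φ) / (k * Real.sin φ) := by
    rw [cosTerm, hθ, hφ]
    ring_nf
  have hcosc : cosTerm a c x k = Real.cos (θ - ψ) / (k * Real.sin ψ) := by
    rw [cosTerm, hθ, hψ]
    ring_nf
  have hsin : sinTerm a b c x k =
      (Real.sin (θ + φ - ψ) + Real.sin (θ - φ + ψ)) / (k * (Real.sin φ * Real.sin ψ)) := by
    rw [sinTerm, ← add_div, ← mul_assoc, hθ, hφ, hψ]
    ring_nf
  have htriple : residuePair {Real.log a, Real.log b, Real.log c}
      (Real.log x + (Real.log a + Real.log b + Real.log c) / 2) (Real.log a) k =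
      -(4 * Real.pi * k)⁻¹ * (Real.sin (θ + φ + ψ) / (Real.sin φ * Real.sin ψ)) := by
    rw [residuePair_triple (log_ne_log_of_coprime ha hb hab) (log_ne_log_of_coprime ha hc hac)
      (log_ne_log_of_coprime hb hc hbc), show
      Real.log x + (Real.log a + Real.log b + Real.log c) / 2 =
        Real.log x + 1 / 2 * Real.log b + 1 / 2 * Real.log c + Real.log a / 2 by ring,
      neg_one_pow_mul_sin_add_half hla, hθ, hφ, hψ]
    ring_nf
  rw [htriple, hadd, hcosb, hcosc, hsin, residuePair_singleton, neg_one_pow_mul_sin_add_half hla,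
    ← hθ]
  ring

theorem residueSum_log_pair (ha : 1 < a) (hb : 1 < b) (hab : a.Coprime b) (x R : ℝ) :
    residueSum {Real.log a, Real.log b} (Real.log x - (Real.log a + Real.log b) / 2) R =
      zeroResidue {Real.log a, Real.log b} (Real.log x - (Real.log a + Real.log b) / 2) -
        1 / (2 * Real.pi) * cosPairSum a b x R := by
  have hb' := residuePair_log_pair hb ha hab.symm x
  rw [Finset.pair_comm, add_comm (Real.log b)] at hb'
  rw [residueSum, Finset.sum_pair (log_ne_log_of_coprime ha hb hab)]
  simp only [residuePair_log_pair ha hb hab, hb', Finset.sum_neg_distrib, ← Finset.mul_sum,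
    cosPairSum]
  ring

theorem sum_residuePair_log_triple (ha : 1 < a) (hb : 1 < b) (hc : 1 < c) (hab : a.Coprime b)
    (hac : a.Coprime c) (hbc : b.Coprime c) (x R : ℝ) :
    ∑ k ∈ Finset.Icc 1 ⌊R * Real.log a⌋₊, residuePair {Real.log a, Real.log b, Real.log c}
        (Real.log x + (Real.log a + Real.log b + Real.log c) / 2) (Real.log a) k =
      ∑ k ∈ Finset.Icc 1 ⌊R * Real.log a⌋₊,
          residuePair {Real.log a} (Real.log x + Real.log a / 2) (Real.log a) k -
        1 / (4 * Real.pi) * (∑ k ∈ Finset.Icc 1 ⌊R * Real.log a⌋₊, cosTerm a b x k +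
          ∑ k ∈ Finset.Icc 1 ⌊R * Real.log a⌋₊, cosTerm a c x k) -
        1 / (8 * Real.pi) * sinSum a b c x R := by
  rw [sinSum, ← Finset.sum_add_distrib, Finset.mul_sum, Finset.mul_sum,
    ← Finset.sum_sub_distrib, ← Finset.sum_sub_distrib]
  exact Finset.sum_congr rfl fun k hk => residuePair_log_triple ha hb hc hab hac hbc x
    (Nat.one_le_iff_ne_zero.1 (Finset.mem_Icc.1 hk).1)

theorem residueSum_log_triple (ha : 1 < a) (hb : 1 < b) (hc : 1 < c) (hab : a.Coprime b)
    (hac : a.Coprime c) (hbc : b.Coprime c) (x R : ℝ) :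
    residueSum {Real.log a, Real.log b, Real.log c}
        (Real.log x + (Real.log a + Real.log b + Real.log c) / 2) R =
      zeroResidue {Real.log a, Real.log b, Real.log c}
          (Real.log x + (Real.log a + Real.log b + Real.log c) / 2) +
        ∑ k ∈ Finset.Icc 1 ⌊R * Real.log a⌋₊,
          residuePair {Real.log a} (Real.log x + Real.log a / 2) (Real.log a) k +
        ∑ k ∈ Finset.Icc 1 ⌊R * Real.log b⌋₊,
          residuePair {Real.log b} (Real.log x + Real.log b / 2) (Real.log b) k +
        ∑ k ∈ Finset.Icc 1 ⌊R * Real.log c⌋₊,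
          residuePair {Real.log c} (Real.log x + Real.log c / 2) (Real.log c) k -
        1 / (4 * Real.pi) * (cosPairSum a b x R + cosPairSum b c x R + cosPairSum c a x R) -
        1 / (8 * Real.pi) * (sinSum a b c x R + sinSum b a c x R + sinSum c a b x R) := by
  have hne := log_ne_log_of_coprime ha hb hab
  have hne' := log_ne_log_of_coprime ha hc hac
  have hb' := sum_residuePair_log_triple hb ha hc hab.symm hbc hac x R
  have hc' := sum_residuePair_log_triple hc ha hb hac.symm hbc.symm hab x R
  rw [Finset.insert_comm, add_comm (Real.log b)] at hb'
  rw [Finset.insert_comm, Finset.pair_comm, add_assoc, add_comm (Real.log c)] at hc'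
  rw [residueSum, Finset.sum_insert (by simp [hne, hne']),
    Finset.sum_pair (log_ne_log_of_coprime hb hc hbc),
    sum_residuePair_log_triple ha hb hc hab hac hbc, hb', hc']
  simp only [cosPairSum]
  ring

end LogResidues

section Limits

variable {R : ℕ → ℝ}

theorem tendsto_sum_residuePair {a u : ℝ} (ha : 0 < a) (hu : 0 ≤ u)
    (hR : Tendsto R atTop atTop) (hav : AvoidsPoles R {a}) :
    Tendsto (fun j => ∑ k ∈ Finset.Icc 1 ⌊R j * a⌋₊, residuePair {a} (u + a / 2) a k) atTop
      (𝓝 (-bernoulliOneStar (u / a))) := by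
  have hlim := tendsto_residueSum (l := [a]) (by simp) (by simp) (by simpa using ha) (by simp) hR
    (by simpa using hav) (u + a / 2)
  simp only [List.toFinset_cons, List.toFinset_nil, insert_empty_eq, residueSum,
    Finset.sum_singleton, zeroResidue_singleton] at hlim
  rw [kernelLimit_of_neg_sum_div_two_lt (by simpa using ha) (by simp; linarith),
    List.sum_singleton, add_sub_cancel_right, latticeCount_singleton ha hu] at hlim
  convert hlim.sub_const ((u + a / 2) / a) using 2
  · ring
  · field_simp
    ring

theorem tendsto_residueSum_log {l : List ℕ} (hlen : l.length ≤ 3) (hl : ∀ n ∈ l, 1 < n)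
    (hcop : l.Pairwise Nat.Coprime) (hR : Tendsto R atTop atTop)
    (hav : AvoidsPoles R (l.map fun n : ℕ => Real.log n).toFinset) (v : ℝ) :
    Tendsto (fun j => residueSum (l.map fun n : ℕ => Real.log n).toFinset v (R j)) atTop
      (𝓝 (kernelLimit (l.map fun n : ℕ => Real.log n) v)) := by
  have hcop' : ∀ m ∈ l, ∀ n ∈ l, m ≠ n → m.Coprime n :=
    have : Std.Symm Nat.Coprime := ⟨fun _ _ h => h.symm⟩
    fun _ hm _ hn => hcop.forall hm hn
  refine tendsto_residueSum ?_ (by simpa using hlen) ?_ ?_ hR hav v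
  · exact List.pairwise_map.2 (hcop.imp_of_mem fun hm hn h =>
      log_ne_log_of_coprime (hl _ hm) (hl _ hn) h)
  · simpa using fun n hn => Real.log_pos (Nat.one_lt_cast.2 (hl n hn))
  · intro α hα β hβ hne
    obtain ⟨m, hm, rfl⟩ := List.mem_map.1 (List.mem_toFinset.1 hα)
    obtain ⟨n, hn, rfl⟩ := List.mem_map.1 (List.mem_toFinset.1 hβ)
    exact irrational_log_div_log (hl m hm) (hl n hn) (hcop' m hm n hn fun h => hne (by rw [h]))

variable {a b c : ℕ}

theorem exists_tendsto_cosPairSum (ha : 1 < a) (hb : 1 < b) (hab : a.Coprime b)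
    (hR : Tendsto R atTop atTop) (hav : AvoidsPoles R {Real.log a, Real.log b}) (x : ℝ) :
    ∃ C, Tendsto (fun j => cosPairSum a b x (R j)) atTop (𝓝 C) := by
  have hlim := tendsto_residueSum_log (l := [a, b]) (by simp) (by simp [ha, hb])
    (by simpa using hab) hR (by simpa using hav)
    (Real.log x - (Real.log a + Real.log b) / 2)
  have heq : ∀ j, cosPairSum a b x (R j) = 2 * Real.pi *
      (zeroResidue {Real.log a, Real.log b} (Real.log x - (Real.log a + Real.log b) / 2) -
        residueSum {Real.log a, Real.log b} (Real.log x - (Real.log a + Real.log b) / 2) (R j)) :=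
    fun j => by
      rw [residueSum_log_pair ha hb hab]
      field_simp
      ring
  simp only [heq]
  exact ⟨_, ((by simpa using hlim : Tendsto (fun j => residueSum {Real.log a, Real.log b}
    (Real.log x - (Real.log a + Real.log b) / 2) (R j)) _ _).const_sub _).const_mul _⟩

theorem tendsto_residueSum_log_triple (ha : 1 < a) (hb : 1 < b) (hc : 1 < c) (hab : a.Coprime b)
    (hac : a.Coprime c) (hbc : b.Coprime c) (hR : Tendsto R atTop atTop)
    (hav : AvoidsPoles R {Real.log a, Real.log b, Real.log c}) {x : ℝ} (hx : 1 ≤ x) :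
    Tendsto (fun j => residueSum {Real.log a, Real.log b, Real.log c}
        (Real.log x + (Real.log a + Real.log b + Real.log c) / 2) (R j)) atTop
      (𝓝 (smoothCount a b c x - 1 / 2 * smoothChi a b c x)) := by
  have hla : 0 < Real.log a := Real.log_pos (Nat.one_lt_cast.2 ha)
  have hlb : 0 < Real.log b := Real.log_pos (Nat.one_lt_cast.2 hb)
  have hlc : 0 < Real.log c := Real.log_pos (Nat.one_lt_cast.2 hc)
  have hu : 0 ≤ Real.log x := Real.log_nonneg hx
  have hsum : [Real.log a, Real.log b, Real.log c].sum = Real.log a + Real.log b + Real.log c := by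
    simp [add_assoc]
  have hlim := tendsto_residueSum_log (l := [a, b, c]) (by simp) (by simp [ha, hb, hc])
    (by simpa using ⟨⟨hab, hac⟩, hbc⟩) hR (by simpa using hav)
    (Real.log x + (Real.log a + Real.log b + Real.log c) / 2)
  simp only [List.map_cons, List.map_nil, List.toFinset_cons, List.toFinset_nil,
    insert_empty_eq] at hlim
  rwa [kernelLimit_of_neg_sum_div_two_lt (by simp [hla, hlb, hlc]) (by rw [hsum]; linarith), hsum,
    add_sub_cancel_right, latticeCount_log ha hb hc hab hac hbc (one_pos.trans_le hx)] at hlim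

theorem exists_tendsto_sinSum (ha : 1 < a) (hb : 1 < b) (hc : 1 < c) (hab : a.Coprime b)
    (hac : a.Coprime c) (hbc : b.Coprime c) (hR : Tendsto R atTop atTop)
    (hav : AvoidsPoles R {Real.log a, Real.log b, Real.log c}) {x : ℝ} (hx : 1 ≤ x)
    {C₁ C₂ C₃ : ℝ} (h₁ : Tendsto (fun j => cosPairSum a b x (R j)) atTop (𝓝 C₁))
    (h₂ : Tendsto (fun j => cosPairSum b c x (R j)) atTop (𝓝 C₂))
    (h₃ : Tendsto (fun j => cosPairSum c a x (R j)) atTop (𝓝 C₃)) :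
    ∃ D, Tendsto (fun j => sinSum a b c x (R j) + sinSum b a c x (R j) + sinSum c a b x (R j))
        atTop (𝓝 D) ∧
      smoothCount a b c x - 1 / 2 * smoothChi a b c x =
        zeroResidue {Real.log a, Real.log b, Real.log c}
          (Real.log x + (Real.log a + Real.log b + Real.log c) / 2) -
        bernoulliOneStar (Real.log x / Real.log a) - bernoulliOneStar (Real.log x / Real.log b) -
        bernoulliOneStar (Real.log x / Real.log c) - 1 / (4 * Real.pi) * (C₁ + C₂ + C₃) -
        1 / (8 * Real.pi) * D := by
  have hu : 0 ≤ Real.log x := Real.log_nonneg hx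
  have ha' := tendsto_sum_residuePair (Real.log_pos (Nat.one_lt_cast.2 ha)) hu hR
    (hav.mono (by simp))
  have hb' := tendsto_sum_residuePair (Real.log_pos (Nat.one_lt_cast.2 hb)) hu hR
    (hav.mono (by simp))
  have hc' := tendsto_sum_residuePair (Real.log_pos (Nat.one_lt_cast.2 hc)) hu hR
    (hav.mono (by simp))
  have htriple := tendsto_residueSum_log_triple ha hb hc hab hac hbc hR hav hx
  have hlim := ((((ha'.const_add (zeroResidue {Real.log a, Real.log b, Real.log c}
    (Real.log x + (Real.log a + Real.log b + Real.log c) / 2))).add hb').add hc').sub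
    (((h₁.add h₂).add h₃).const_mul (1 / (4 * Real.pi)))).sub htriple
  refine ⟨_, (hlim.const_mul (8 * Real.pi)).congr fun j => ?_, ?_⟩
  · rw [residueSum_log_triple ha hb hc hab hac hbc]
    field_simp
    ring
  · field_simp
    ring

end Limits

theorem corollary8_general {a b c : ℕ} (ha : 1 < a) (hb : 1 < b) (hc : 1 < c)
    (hab : a.Coprime b) (hac : a.Coprime c) (hbc : b.Coprime c) :
    ∃ R : ℕ → ℝ, Tendsto R atTop atTop ∧
      ∀ x : ℝ, 1 ≤ x →
        ∃ C₁ C₂ C₃ D : ℝ,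
          Tendsto (fun j => cosPairSum a b x (R j)) atTop (𝓝 C₁) ∧
          Tendsto (fun j => cosPairSum b c x (R j)) atTop (𝓝 C₂) ∧
          Tendsto (fun j => cosPairSum c a x (R j)) atTop (𝓝 C₃) ∧
          Tendsto (fun j => sinSum a b c x (R j) + sinSum b a c x (R j) + sinSum c a b x (R j))
            atTop (𝓝 D) ∧
          (smoothCount a b c x : ℝ) =
            Real.log x ^ 3 / (6 * Real.log a * Real.log b * Real.log c)
            + Real.log x ^ 2 / (4 * Real.log a * Real.log b)
            + Real.log x ^ 2 / (4 * Real.log a * Real.log c)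
            + Real.log x ^ 2 / (4 * Real.log b * Real.log c)
            + Real.log x / (4 * Real.log a)
            + Real.log x / (4 * Real.log b)
            + Real.log x / (4 * Real.log c)
            + Real.log a * Real.log x / (12 * Real.log b * Real.log c)
            + Real.log b * Real.log x / (12 * Real.log a * Real.log c)
            + Real.log c * Real.log x / (12 * Real.log a * Real.log b)
            + Real.log a / (24 * Real.log b) + Real.log a / (24 * Real.log c)
            + Real.log b / (24 * Real.log a) + Real.log b / (24 * Real.log c)
            + Real.log c / (24 * Real.log a) + Real.log c / (24 * Real.log b)
            + 1 / 8
            - bernoulliOneStar (Real.log x / Real.log a)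
            - bernoulliOneStar (Real.log x / Real.log b)
            - bernoulliOneStar (Real.log x / Real.log c)
            - 1 / (4 * Real.pi) * C₁
            - 1 / (4 * Real.pi) * C₂
            - 1 / (4 * Real.pi) * C₃
            - 1 / (8 * Real.pi) * D
            + 1 / 2 * smoothChi a b c x := by
  have hla : 0 < Real.log a := Real.log_pos (Nat.one_lt_cast.2 ha)
  have hlb : 0 < Real.log b := Real.log_pos (Nat.one_lt_cast.2 hb)
  have hlc : 0 < Real.log c := Real.log_pos (Nat.one_lt_cast.2 hc)
  obtain ⟨R, hR, hav⟩ := exists_tendsto_avoidsPoles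
    (s := {Real.log a, Real.log b, Real.log c}) (by simp [hla, hlb, hlc])
  refine ⟨R, hR, fun x hx => ?_⟩
  obtain ⟨C₁, h₁⟩ := exists_tendsto_cosPairSum ha hb hab hR (hav.mono (by grind)) x
  obtain ⟨C₂, h₂⟩ := exists_tendsto_cosPairSum hb hc hbc hR (hav.mono (by grind)) x
  obtain ⟨C₃, h₃⟩ := exists_tendsto_cosPairSum hc ha hac.symm hR (hav.mono (by grind)) x
  obtain ⟨D, hD, hcount⟩ := exists_tendsto_sinSum ha hb hc hab hac hbc hR hav hx h₁ h₂ h₃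
  rw [zeroResidue_triple_add_half hla hlb hlc (log_ne_log_of_coprime ha hb hab)
    (log_ne_log_of_coprime ha hc hac) (log_ne_log_of_coprime hb hc hbc)] at hcount
  exact ⟨C₁, C₂, C₃, D, h₁, h₂, h₃, hD, by linear_combination hcount⟩

theorem corollary8 :
    ∃ R : ℕ → ℝ, Tendsto R atTop atTop ∧
      ∀ x : ℝ, 1 ≤ x →
        ∃ C₂₃ C₃₅ C₅₂ D : ℝ,
          Tendsto (fun j => cosPairSum 2 3 x (R j)) atTop (𝓝 C₂₃) ∧
          Tendsto (fun j => cosPairSum 3 5 x (R j)) atTop (𝓝 C₃₅) ∧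
          Tendsto (fun j => cosPairSum 5 2 x (R j)) atTop (𝓝 C₅₂) ∧
          Tendsto (fun j => sinSum 2 3 5 x (R j) + sinSum 3 2 5 x (R j) + sinSum 5 2 3 x (R j))
            atTop (𝓝 D) ∧
          (smoothCount 2 3 5 x : ℝ) =
            Real.log x ^ 3 / (6 * Real.log 2 * Real.log 3 * Real.log 5)
            + Real.log x ^ 2 / (4 * Real.log 2 * Real.log 3)
            + Real.log x ^ 2 / (4 * Real.log 2 * Real.log 5)
            + Real.log x ^ 2 / (4 * Real.log 3 * Real.log 5)
            + Real.log x / (4 * Real.log 2)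
            + Real.log x / (4 * Real.log 3)
            + Real.log x / (4 * Real.log 5)
            + Real.log 2 * Real.log x / (12 * Real.log 3 * Real.log 5)
            + Real.log 3 * Real.log x / (12 * Real.log 2 * Real.log 5)
            + Real.log 5 * Real.log x / (12 * Real.log 2 * Real.log 3)
            + Real.log 2 / (24 * Real.log 3) + Real.log 2 / (24 * Real.log 5)
            + Real.log 3 / (24 * Real.log 2) + Real.log 3 / (24 * Real.log 5)
            + Real.log 5 / (24 * Real.log 2) + Real.log 5 / (24 * Real.log 3)
            + 1 / 8
            - bernoulliOneStar (Real.log x / Real.log 2)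
            - bernoulliOneStar (Real.log x / Real.log 3)
            - bernoulliOneStar (Real.log x / Real.log 5)
            - 1 / (4 * Real.pi) * C₂₃
            - 1 / (4 * Real.pi) * C₃₅
            - 1 / (4 * Real.pi) * C₅₂
            - 1 / (8 * Real.pi) * D
            + 1 / 2 * smoothChi 2 3 5 x := by
  simpa only [Nat.cast_ofNat] using corollary8_general (a := 2) (b := 3) (c := 5)
    (by norm_num) (by norm_num) (by norm_num) (by norm_num) (by norm_num) (by norm_num)
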